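/- Let $R$ be a $3$-dimensional (Noetherian) Cohen–Macaulay local ring in which $2$ is a unit, let $x,y,z$ be a system of parameters of $R$, and let $\alpha=1$, $\alpha'=2$ and $\beta,\gamma,\beta',\gamma'$ be positive integers with $2\beta\le\beta'$ and $2\gamma\le\gamma'$. Let $I$ be the ideal generated by the maximal minors of $$\begin{pmatrix} x^{\alpha} & y^{\beta} & z^{\gamma}\\ y^{\beta'} & z^{\gamma'} & x^{\alpha'}\end{pmatrix},$$ let $Q=(x^{\min\{\alpha,\alpha'\}},y^{\min\{\beta,\beta'\}},z^{\min\{\gamma,\gamma'\}})R=(x,y^\beta,z^\gamma)R$, and let $I^{(3)}=\bigcap_{\mathfrak p\in\operatorname{Min}(R/I)}(I^3R_{\mathfrak p}\cap R)$ be the third symbolic power of $I$. Notation. Let $S_d$ be the degree $d$ part of $S=R[A,B,C]$; for $h\in S_2$ write $[h]=(h,0)$ and $\langle h\rangle=(0,h)$ in $S_2\oplus S_2$. Put $f=xA+y^\beta B+z^\gamma C$, $g=y^{\beta'}A+z^{\gamma'}B+x^{2}C$. For $M\in\{A,B,C\}$ put $$v^1_{(1,M)}=\langle AM\rangle-x[CM],\quad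 v^1_{(2,M)}=\langle BM\rangle-y^{\beta'-\beta}[AM],\quad v^1_{(3,M)}=\langle CM\rangle-z^{\gamma'-\gamma}[BM].$$ Let $K_\bullet$ be the Koszul complex of $x_1=x,\ x_2=y^\beta,\ x_3=z^\gamma$, with basis $e_1,e_2,e_3$ of $K_1$, with $\check e_1=e_2\wedge e_3$, $\check e_2=e_1\wedge e_3$, $\check e_3=e_1\wedge e_2$, and with $\partial_2(e_s\wedge e_t)=x_se_t-x_te_s$. Let $$\varphi:K_2\otimes S_1\to(K_1\otimes S_1)\oplus(S_2\oplus S_2),\qquad \check e_i\otimes M\mapsto\bigl(\partial_2(\check e_i)\otimes M,\ (-1)^i v^1_{(i,M)}\bigr).$$ Let $F$ be the submodule of the target generated by the elements $[i,M]=(e_i\otimes M,0)$ and $\langle[N]\rangle=(0,[N])$, for $i\in\{1,2,3\}$, $M\in\{A,B,C\}$ and $N$ a monomial of degree $2$. Let $$w_{1B}=-\check e_1\otimes B-\check e_2\otimes A,\quad w_{1C}=-\check e_1\otimes C+\check e_3\otimes A,\quad w_{2C}=\check e_2\otimes C+\check e_3\otimes B,$$ and let $v_{(j,\lambda)}\in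 F$, for $j\in\{1,2,3\}$ and $\lambda\in\{1B,1C,2C\}$, be the nine elements $$\begin{aligned} v_{(1,1B)}&=-[3,A]-\langle[BC]\rangle, & v_{(2,1B)}&=-[3,B]+y^{\beta'-2\beta}\langle[A^2]\rangle, & v_{(3,1B)}&=[2,B]+[1,A],\\ v_{(1,1C)}&=[2,A]-\langle[C^2]\rangle, & v_{(2,1C)}&=-[3,C]-[1,A], & v_{(3,1C)}&=[2,C]+z^{\gamma'-2\gamma}\langle[AB]\rangle,\\ v_{(1,2C)}&=[3,C]+[2,B], & v_{(2,2C)}&=-[1,B]-y^{\beta'-2\beta}\langle[AC]\rangle, & v_{(3,2C)}&=-[1,C]+z^{\gamma'-2\gamma}\langle[B^2]\rangle. \end{aligned}$$ Then: 1. One has $(-gM,fM)=x\,v^1_{(1,M)}+y^\beta v^1_{(2,M)}+z^\gamma v^1_{(3,M)}$ for all $M\in\{A,B,C\}$ and $\varphi(w_\lambda)=x\,v_{(1,\lambda)}+y^\beta v_{(2,\lambda)}+z^\gamma v_{(3,\lambda)}$ for all $\lambda\in\{1B,1C,2C\}$; and the nine elements $v_{(j,\lambda)}$ are part of a free $R$-basis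 of $F$, that is, there is a subset $U\subseteq F$ such that the $v_{(j,\lambda)}$ together with $U$ form a free basis of $F$. 2. $\operatorname{depth} R/(I^3:_RQ^2)>0$. 3. $I^{(3)}=I^3:_RQ^2$. 4. $\ell_R(I^{(3)}/I^3)=6\cdot\ell_R(R/Q)$. -/

import Mathlib

open IsLocalRing

noncomputable section

/-- The depth of a module over a local ring: the supremum of the lengths of the `M`-regular
sequences contained in the maximal ideal (used for nonzero finitely generated modules). -/
def localDepth (R : Type*) [CommRing R] [IsLocalRing R] (M : Type*) [AddCommGroup M]
    [Module R M] : ℕ∞ :=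
  ⨆ rs : {rs : List R // RingTheory.Sequence.IsRegular M rs ∧ ∀ r ∈ rs, r ∈ maximalIdeal R},
    (rs.1.length : ℕ∞)

/-- A Noetherian local ring is Cohen-Macaulay when its depth equals its Krull dimension. -/
def IsCohenMacaulayLocal (R : Type*) [CommRing R] [IsLocalRing R] : Prop :=
  IsNoetherianRing R ∧ (localDepth R R : WithBot ℕ∞) = ringKrullDim R

/-- A system of parameters: `dim R` elements generating an ideal primary to the maximal ideal. -/
def IsSystemOfParameters {R : Type*} [CommRing R] [IsLocalRing R] {d : ℕ} (s : Fin d → R) :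
    Prop :=
  ringKrullDim R = d ∧ (Ideal.span (Set.range s)).radical = maximalIdeal R

/-- The `n`-th symbolic power: the intersection, over the minimal primes `p` of `R / I`,
of the contractions to `R` of `I ^ n R_p`. -/
def symbolicPower {R : Type*} [CommRing R] (I : Ideal R) (n : ℕ) : Ideal R :=
  ⨅ p : I.minimalPrimes,
    haveI : p.1.IsPrime := p.2.1.1
    ((I ^ n).map (algebraMap R (Localization.AtPrime p.1))).comap
      (algebraMap R (Localization.AtPrime p.1))

/-- The ideal generated by the maximal minors of an `m × n` matrix (`m ≤ n`). -/
def maximalMinorsIdeal {R : Type*} [CommRing R] {m n : ℕ} (A : Matrix (Fin m) (Fin n) R) :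
    Ideal R :=
  Ideal.span (Set.range fun e : Fin m ↪o Fin n => (A.submatrix id e).det)

namespace StarTransform

variable {R : Type*} [CommRing R]

/-- `Admissible v T` : the part of the family `v` indexed by `T` can be completed, by some
subset `U`, to a free basis of the module. -/
def Admissible {F ι : Type*} [AddCommGroup F] [Module R F] (v : ι → F) (T : Set ι) : Prop :=
  ∃ (U : Set F) (b : Module.Basis (T ⊕ U) R F),
    (∀ t : T, b (Sum.inl t) = v t) ∧ ∀ u : U, b (Sum.inr u) = u

/-- With `K` the Koszul complex of `ξ 0, ξ 1, ξ 2` and `F₃` free with basis `w` indexed by `Λ`,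
the modules `K₁ ⊗ F₃` and `K₂ ⊗ F₃` are both written as `Fin 3 × Λ → R`, through the bases
`e i ⊗ w l` and `ě i ⊗ w l`, where `ě i = e s ∧ e t` with `s < t` and `{i, s, t} = {0, 1, 2}`.
For a family `v` in `F₂` this is the map
`K₂ ⊗ F₃ → (K₁ ⊗ F₃) ⊕ F₂`, `ě i ⊗ w l ↦ (∂₂ (ě i) ⊗ w l, (-1) ^ (i + 1) • v (i, l))`, where
`∂₂ (e s ∧ e t) = ξ s • e t - ξ t • e s`.
(Indices start at `0`; the sign is `(-1) ^ i` when they start at `1`.) -/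
def phi3 (ξ : Fin 3 → R) {Λ F₂ : Type*} [Fintype Λ] [DecidableEq Λ] [AddCommGroup F₂]
    [Module R F₂] (v : Fin 3 × Λ → F₂) : (Fin 3 × Λ → R) →ₗ[R] (Fin 3 × Λ → R) × F₂ :=
  Fintype.linearCombination R fun p =>
    (Pi.single (p.1.succAbove 1, p.2) (ξ (p.1.succAbove 0)) -
        Pi.single (p.1.succAbove 0, p.2) (ξ (p.1.succAbove 1)),
      (-1 : R) ^ (p.1.val + 1) • v p)

/-- The submodule of `(K₁ ⊗ F₃) ⊕ F₂` generated by all `e i ⊗ w l` and by `U ⊆ F₂`. -/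
def starF2 (Λ : Type*) [DecidableEq Λ] {F₂ : Type*} [AddCommGroup F₂] [Module R F₂]
    (U : Set F₂) : Submodule R ((Fin 3 × Λ → R) × F₂) :=
  Submodule.span R
    ((Set.range fun p : Fin 3 × Λ => (Pi.single p (1 : R), (0 : F₂))) ∪
      (fun u : F₂ => ((0 : Fin 3 × Λ → R), u)) '' U)

/-- The degree two part `S₂` of `R[A, B, C]`, with basis the monomials of degree two.
The variables `A, B, C` are `0, 1, 2 : Fin 3`, and the product of two variables `M`, `N` is
`s(M, N) : Sym2 (Fin 3)`. -/
abbrev S2 (R : Type*) := Sym2 (Fin 3) → R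

/-- A monomial of degree two in the first summand of `S₂ ⊕ S₂`. -/
def sq (R : Type*) [CommRing R] (N : Sym2 (Fin 3)) : S2 R × S2 R := (Pi.single N 1, 0)

/-- A monomial of degree two in the second summand of `S₂ ⊕ S₂`. -/
def an (R : Type*) [CommRing R] (N : Sym2 (Fin 3)) : S2 R × S2 R := (0, Pi.single N 1)

/-- For `f = x A + y ^ β B + z ^ γ C` and `g = y ^ β' A + z ^ γ' B + x ^ 2 C`, the map
`S₁ → S₂ ⊕ S₂`, `h ↦ (- g h, f h)`, on the basis `A, B, C` of `S₁`. -/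
def phi13 (x y z : R) (β γ β' γ' : ℕ) (M : Fin 3) : S2 R × S2 R :=
  -(y ^ β' • sq R s(0, M) + z ^ γ' • sq R s(1, M) + x ^ 2 • sq R s(2, M)) +
    (x • an R s(0, M) + y ^ β • an R s(1, M) + z ^ γ • an R s(2, M))

/-- The family `v¹`, for which
`phi13 M = x • v¹ (0, M) + y ^ β • v¹ (1, M) + z ^ γ • v¹ (2, M)`. -/
def v1 (x y z : R) (β γ β' γ' : ℕ) (p : Fin 3 × Fin 3) : S2 R × S2 R :=
  match p.1 with
  | 0 => an R s(0, p.2) - x • sq R s(2, p.2)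
  | 1 => an R s(1, p.2) - y ^ (β' - β) • sq R s(0, p.2)
  | 2 => an R s(2, p.2) - z ^ (γ' - γ) • sq R s(1, p.2)

/-- The module `F²₂`, generated in `(K₁ ⊗ S₁) ⊕ (S₂ ⊕ S₂)` by `K₁ ⊗ S₁` and by the monomials
of the first summand `S₂`. -/
abbrev F22 (R : Type*) [CommRing R] :
    Submodule R ((Fin 3 × Fin 3 → R) × (S2 R × S2 R)) :=
  starF2 (Fin 3) (Set.range (sq R))

/-- The element `[i, M]` of `F²₂`. -/
def br (R : Type*) [CommRing R] (i M : Fin 3) : F22 R :=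
  ⟨(Pi.single (i, M) 1, 0), Submodule.subset_span (Or.inl ⟨(i, M), rfl⟩)⟩

/-- The element `⟨[N]⟩` of `F²₂`. -/
def abr (R : Type*) [CommRing R] (N : Sym2 (Fin 3)) : F22 R :=
  ⟨(0, sq R N), Submodule.subset_span (Or.inr ⟨sq R N, ⟨N, rfl⟩, rfl⟩)⟩

/-- The basis `w²` of `F²₃`, in the order `(1, B)`, `(1, C)`, `(2, C)`:
`-ě₁ ⊗ B - ě₂ ⊗ A`, `-ě₁ ⊗ C + ě₃ ⊗ A`, `ě₂ ⊗ C + ě₃ ⊗ B`. -/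
def w2 (R : Type*) [CommRing R] (l : Fin 3) : Fin 3 × Fin 3 → R :=
  match l with
  | 0 => -Pi.single (0, 1) 1 - Pi.single (1, 0) 1
  | 1 => -Pi.single (0, 2) 1 + Pi.single (2, 0) 1
  | 2 => Pi.single (1, 2) 1 + Pi.single (2, 1) 1

/-- The family `v²` in `F²₂`. The second index `0, 1, 2` stands for
`(1, B)`, `(1, C)`, `(2, C)`. -/
def v2 (y z : R) (β γ β' γ' : ℕ) (p : Fin 3 × Fin 3) : F22 R :=
  match p with
  | (0, 0) => -br R 2 0 - abr R s(1, 2)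
  | (1, 0) => -br R 2 1 + y ^ (β' - 2 * β) • abr R s(0, 0)
  | (2, 0) => br R 1 1 + br R 0 0
  | (0, 1) => br R 1 0 - abr R s(2, 2)
  | (1, 1) => -br R 2 2 - br R 0 0
  | (2, 1) => br R 1 2 + z ^ (γ' - 2 * γ) • abr R s(0, 1)
  | (0, 2) => br R 2 2 + br R 1 1
  | (1, 2) => -br R 0 1 - y ^ (β' - 2 * β) • abr R s(0, 2)
  | (2, 2) => -br R 0 2 + z ^ (γ' - 2 * γ) • abr R s(1, 1)

end StarTransform

end

/-!
The linear forms `f, g` whose coefficients are the rows of the matrix generate the kernel of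
`R[A, B, C] → R[It]`, so the degree `3` strand `0 → S₁ → S₂ ⊕ S₂ → S₃ → R` of their Koszul complex
is a free resolution of `R/I³`. For an ideal `J` generated by a system of parameters, both
`(I³ : J)/I³` and the kernel of `S₁/JS₁ → S₂/JS₂ ⊕ S₂/JS₂` compute `Tor₃(R/J, R/I³)`. That kernel
consists of the linear forms annihilated by `f` and `g` modulo `J`; since `2` is a unit it is killed
by `Q²`, hence `I³ : J ⊆ I³ : Q²`. As `R/I` has dimension one, every element of the third symbolic
power lies in such an `I³ : J`; since `Q` is contained in no minimal prime of `I`, the symbolic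
power is `I³ : Q²`, and it also equals `I³ : J` for `J = (x², y²ᵝ, z²ᵞ)`. Modulo this `J` the form
`g` vanishes, and the linear forms annihilated by `f` have length `6 · ℓ(R/Q)`.
-/

/-- The Koszul complex of `u, v, w` with coefficients in `M` is exact in positive degrees, spelled
out on elements; `one`, `two` and `three` are the exactness in the degree they are named after. -/
structure KoszulAcyclic {R : Type*} [CommRing R] (u v w : R) (M : Type*) [AddCommGroup M]
    [Module R M] : Prop where
  one : ∀ m₁ m₂ m₃ : M, u • m₁ + v • m₂ + w • m₃ = 0 →
    ∃ n₁ n₂ n₃ : M, m₁ = v • n₃ - w • n₂ ∧ m₂ = w • n₁ - u • n₃ ∧ m₃ = u • n₂ - v • n₁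
  two : ∀ m₁ m₂ m₃ : M, v • m₁ = u • m₂ → w • m₁ = u • m₃ → w • m₂ = v • m₃ →
    ∃ n : M, m₁ = u • n ∧ m₂ = v • n ∧ m₃ = w • n
  three : ∀ m : M, u • m = 0 → v • m = 0 → w • m = 0 → m = 0

section DepthSensitivity

open RingTheory.Sequence

variable {R M : Type*} [CommRing R] [AddCommGroup M] [Module R M] {u v w r : R}

lemma eq_zero_of_isSMulRegular_of_mem_span (hr : IsSMulRegular M r)
    (hmem : r ∈ Ideal.span {u, v, w}) {m : M} (hu : u • m = 0) (hv : v • m = 0) (hw : w • m = 0) :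
    m = 0 := by
  obtain ⟨a, b, c, rfl⟩ := Submodule.mem_span_triple.mp hmem
  apply hr.right_eq_zero_of_smul
  linear_combination (norm := module) a • hu + b • hv + c • hw

lemma quotSMulTop_mk_eq_zero_iff {m : M} :
    (Submodule.Quotient.mk m : QuotSMulTop r M) = 0 ↔ ∃ n : M, r • n = m := by
  rw [Submodule.Quotient.mk_eq_zero, Submodule.mem_smul_pointwise_iff_exists]
  simp only [Submodule.mem_top, true_and]

lemma exists_eq_smul_of_isSMulRegular_of_mem_span (hr : IsSMulRegular M r)
    (hmem : r ∈ Ideal.span {u, v, w})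
    (three : ∀ m : QuotSMulTop r M, u • m = 0 → v • m = 0 → w • m = 0 → m = 0) {m₁ m₂ m₃ : M}
    (h₁₂ : v • m₁ = u • m₂) (h₁₃ : w • m₁ = u • m₃) (h₂₃ : w • m₂ = v • m₃) :
    ∃ n : M, m₁ = u • n ∧ m₂ = v • n ∧ m₃ = w • n := by
  obtain ⟨a, b, c, habc⟩ := Submodule.mem_span_triple.mp hmem
  have hu : r • m₁ = u • (a • m₁ + b • m₂ + c • m₃) := by
    rw [← habc]; linear_combination (norm := module) b • h₁₂ + c • h₁₃
  have hv : r • m₂ = v • (a • m₁ + b • m₂ + c • m₃) := by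
    rw [← habc]; linear_combination (norm := module) c • h₂₃ - a • h₁₂
  have hw : r • m₃ = w • (a • m₁ + b • m₂ + c • m₃) := by
    rw [← habc]; linear_combination (norm := module) -a • h₁₃ - b • h₂₃
  obtain ⟨n, hn⟩ := quotSMulTop_mk_eq_zero_iff.mp <| three (Submodule.Quotient.mk _)
    (quotSMulTop_mk_eq_zero_iff.mpr ⟨_, hu⟩) (quotSMulTop_mk_eq_zero_iff.mpr ⟨_, hv⟩)
    (quotSMulTop_mk_eq_zero_iff.mpr ⟨_, hw⟩)
  rw [← hn] at hu hv hw
  exact ⟨n, hr (hu.trans (smul_comm _ _ _)), hr (hv.trans (smul_comm _ _ _)),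
    hr (hw.trans (smul_comm _ _ _))⟩

lemma exists_koszul_relation_of_isSMulRegular_of_mem_span (hr : IsSMulRegular M r)
    (hmem : r ∈ Ideal.span {u, v, w})
    (two : ∀ m₁ m₂ m₃ : QuotSMulTop r M, v • m₁ = u • m₂ → w • m₁ = u • m₃ → w • m₂ = v • m₃ →
      ∃ n : QuotSMulTop r M, m₁ = u • n ∧ m₂ = v • n ∧ m₃ = w • n) {m₁ m₂ m₃ : M}
    (h : u • m₁ + v • m₂ + w • m₃ = 0) :
    ∃ n₁ n₂ n₃ : M, m₁ = v • n₃ - w • n₂ ∧ m₂ = w • n₁ - u • n₃ ∧ m₃ = u • n₂ - v • n₁ := by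
  obtain ⟨a, b, c, habc⟩ := Submodule.mem_span_triple.mp hmem
  have mk_eq : ∀ {m m' n : M}, m = m' + r • n →
      (Submodule.Quotient.mk m : QuotSMulTop r M) = Submodule.Quotient.mk m' := fun h => by
    rw [← sub_eq_zero, ← Submodule.Quotient.mk_sub, quotSMulTop_mk_eq_zero_iff]
    exact ⟨_, (sub_eq_of_eq_add' h).symm⟩
  obtain ⟨t, h₁, h₂, h₃⟩ := two (Submodule.Quotient.mk (c • m₂ - b • m₃))
    (Submodule.Quotient.mk (a • m₃ - c • m₁)) (Submodule.Quotient.mk (b • m₁ - a • m₂))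
    (mk_eq (n := -m₃) (by rw [← habc]; linear_combination (norm := module) c • h))
    (mk_eq (n := m₂) (by rw [← habc]; linear_combination (norm := module) -b • h))
    (mk_eq (n := -m₁) (by rw [← habc]; linear_combination (norm := module) a • h))
  obtain ⟨t, rfl⟩ := Submodule.Quotient.mk_surjective _ t
  rw [← sub_eq_zero, ← Submodule.Quotient.mk_smul, ← Submodule.Quotient.mk_sub,
    quotSMulTop_mk_eq_zero_iff] at h₁ h₂ h₃
  obtain ⟨k₁, h₁⟩ := h₁
  obtain ⟨k₂, h₂⟩ := h₂
  obtain ⟨k₃, h₃⟩ := h₃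
  refine ⟨k₁, k₂, k₃, hr ?_, hr ?_, hr ?_⟩ <;> dsimp only
  · linear_combination (norm := (rw [← habc]; module)) w • h₂ - v • h₃ + a • h
  · linear_combination (norm := (rw [← habc]; module)) u • h₃ - w • h₁ + b • h
  · linear_combination (norm := (rw [← habc]; module)) v • h₁ - u • h₂ + c • h

lemma koszulAcyclic_of_isWeaklyRegular {r₁ r₂ r₃ : R} (hr : IsWeaklyRegular M [r₁, r₂, r₃])
    (h₁ : r₁ ∈ Ideal.span {u, v, w}) (h₂ : r₂ ∈ Ideal.span {u, v, w})
    (h₃ : r₃ ∈ Ideal.span {u, v, w}) : KoszulAcyclic u v w M := by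
  simp only [isWeaklyRegular_cons_iff, IsWeaklyRegular.nil, and_true] at hr
  obtain ⟨hr₁, hr₂, hr₃⟩ := hr
  exact
    { one := fun _ _ _ => exists_koszul_relation_of_isSMulRegular_of_mem_span hr₁ h₁
        fun _ _ _ => exists_eq_smul_of_isSMulRegular_of_mem_span hr₂ h₂
          fun _ => eq_zero_of_isSMulRegular_of_mem_span hr₃ h₃
      two := fun _ _ _ => exists_eq_smul_of_isSMulRegular_of_mem_span hr₁ h₁
        fun _ => eq_zero_of_isSMulRegular_of_mem_span hr₂ h₂
      three := fun _ => eq_zero_of_isSMulRegular_of_mem_span hr₁ h₁ }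

end DepthSensitivity

namespace KoszulAcyclic

variable {R M : Type*} [CommRing R] [AddCommGroup M] [Module R M] {u v w : R}

lemma rotate (h : KoszulAcyclic u v w M) : KoszulAcyclic v w u M where
  one m₁ m₂ m₃ e := by
    obtain ⟨n₁, n₂, n₃, h₁, h₂, h₃⟩ := h.one m₃ m₁ m₂ (by rw [← e]; abel)
    exact ⟨n₂, n₃, n₁, h₂, h₃, h₁⟩
  two m₁ m₂ m₃ h₁₂ h₁₃ h₂₃ := by
    obtain ⟨n, h₁, h₂, h₃⟩ := h.two m₃ m₁ m₂ h₁₃.symm h₂₃.symm h₁₂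
    exact ⟨n, h₂, h₃, h₁⟩
  three m hv hw hu := h.three m hu hv hw

lemma isSMulRegular_quotient_span_pair (h : KoszulAcyclic u v w R) :
    IsSMulRegular (R ⧸ Ideal.span {u, v}) w := by
  refine isSMulRegular_quotient_iff_mem_of_smul_mem _ _ |>.mpr fun m hm => ?_
  obtain ⟨a, b, hab⟩ := Ideal.mem_span_pair.mp hm
  obtain ⟨n₁, n₂, -, -, -, rfl⟩ := h.one (-a) (-b) m (by
    simp only [smul_eq_mul] at hab ⊢; linear_combination -hab)
  exact Ideal.mem_span_pair.mpr ⟨n₂, -n₁, by simp only [smul_eq_mul]; ring⟩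

variable [IsLocalRing R] [IsNoetherianRing R]

lemma isSMulRegular_quotient_span_singleton (h : KoszulAcyclic u v w R)
    (hw : w ∈ maximalIdeal R) : IsSMulRegular (R ⧸ Ideal.span {u}) v := by
  suffices hle : (Ideal.span {u}).colon {v} ≤ Ideal.span {u} by
    refine isSMulRegular_quotient_iff_mem_of_smul_mem _ _ |>.mpr fun m hm => hle ?_
    rwa [Submodule.mem_colon_singleton, smul_eq_mul, mul_comm]
  refine Submodule.le_of_le_smul_of_le_jacobson_bot (IsNoetherian.noetherian _)
    (maximalIdeal_le_jacobson ⊥) fun m hm => ?_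
  obtain ⟨m', hm⟩ := Ideal.mem_span_singleton.mp (Submodule.mem_colon_singleton.mp hm)
  obtain ⟨n₁, n₂, n₃, -, rfl, h₃⟩ := h.one (-m') m 0 (by
    simp only [smul_eq_mul] at hm ⊢; linear_combination hm)
  rw [sub_eq_neg_add]
  refine Submodule.add_mem_sup (neg_mem (Ideal.mem_span_singleton'.mpr ⟨n₃, mul_comm _ _⟩))
    (Submodule.smul_mem_smul hw (Submodule.mem_colon_singleton.mpr ?_))
  exact Ideal.mem_span_singleton.mpr ⟨n₂, by simp only [smul_eq_mul] at h₃ ⊢; linear_combination h₃⟩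

lemma isSMulRegular (h : KoszulAcyclic u v w R) (hv : v ∈ maximalIdeal R)
    (hw : w ∈ maximalIdeal R) : IsSMulRegular R u := by
  suffices hle : (⊥ : Ideal R).colon {u} ≤ ⊥ by
    refine IsSMulRegular.of_right_eq_zero_of_smul fun m hm => hle ?_
    rwa [Submodule.mem_colon_singleton, smul_eq_mul, mul_comm]
  refine Submodule.le_of_le_smul_of_le_jacobson_bot (IsNoetherian.noetherian _)
    (maximalIdeal_le_jacobson ⊥) fun m hm => ?_
  have hm : m * u = 0 := Submodule.mem_colon_singleton.mp hm
  obtain ⟨n₁, n₂, n₃, rfl, h₂, h₃⟩ := h.one m 0 0 (by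
    simp only [smul_eq_mul]; linear_combination hm)
  simp only [smul_eq_mul] at h₂ h₃ hm ⊢
  obtain ⟨n, rfl⟩ : u ∣ n₁ := Ideal.mem_span_singleton.mp <|
    mem_of_isSMulRegular_quotient_of_smul_mem (h.isSMulRegular_quotient_span_singleton hw)
      (Ideal.mem_span_singleton.mpr ⟨n₂, by simp only [smul_eq_mul]; linear_combination h₃⟩)
  rw [bot_sup_eq, show v * n₃ - w * n₂ = v * (n₃ - w * n) - w * (n₂ - v * n) by ring]
  refine sub_mem (Submodule.smul_mem_smul hv ?_) (Submodule.smul_mem_smul hw ?_) <;>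
    rw [Submodule.mem_colon_singleton, smul_eq_mul, Ideal.mem_bot]
  · linear_combination h₂
  · linear_combination -h₃

end KoszulAcyclic

section CohenMacaulay

open CategoryTheory.Abelian RingTheory.Sequence

variable {R : Type*} [CommRing R] [IsLocalRing R]

lemma exists_isRegular_of_le_localDepth {n : ℕ} (h : n ≤ localDepth R R) :
    ∃ rs : List R, n ≤ rs.length ∧ IsRegular R rs ∧ ∀ r ∈ rs, r ∈ maximalIdeal R := by
  cases n with
  | zero => exact ⟨[], le_rfl, .nil R R, by simp⟩
  | succ n =>
    obtain ⟨⟨rs, hreg, hmem⟩, hlt⟩ := lt_iSup_iff.mp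
      ((Nat.cast_lt.mpr n.lt_succ_self).trans_le h)
    exact ⟨rs, Nat.cast_lt.mp hlt, hreg, hmem⟩

lemma exists_isRegular_mem_of_le_localDepth [IsNoetherianRing R] {n : ℕ}
    (h : n ≤ localDepth R R) {J : Ideal R} (hJ : J.radical = maximalIdeal R) :
    ∃ rs : List R, rs.length = n ∧ (∀ r ∈ rs, r ∈ J) ∧ IsRegular R rs := by
  obtain ⟨rs, hlen, hreg, hmem⟩ := exists_isRegular_of_le_localDepth h
  have smul_top_lt : ∀ K ≤ maximalIdeal R, K • (⊤ : Submodule R R) < ⊤ := fun K hK => by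
    rw [smul_eq_mul, Ideal.mul_top]
    exact hK.trans_lt Ideal.IsPrime.ne_top'.lt_top
  have supp : Module.support R (R ⧸ maximalIdeal R) = PrimeSpectrum.zeroLocus (maximalIdeal R) := by
    rw [Module.support_eq_zeroLocus, Ideal.annihilator_quotient]
  have ext_vanish := ModuleCat.subsingleton_ext_of_exists_isRegular (maximalIdeal R)
    (ModuleCat.of R (R ⧸ maximalIdeal R)) supp.subset (ModuleCat.of R R)
    (smul_top_lt _ le_rfl) rs hmem hreg
  refine ModuleCat.exists_isRegular_of_exists_subsingleton_ext J n (ModuleCat.of R R)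
    (smul_top_lt _ (hJ ▸ Ideal.le_radical)) (ModuleCat.of R (R ⧸ maximalIdeal R)) ?_
    fun i hi => ext_vanish i (hi.trans_le hlen)
  rw [supp, PrimeSpectrum.zeroLocus_eq_iff, hJ, (maximalIdeal.isMaximal R).isPrime.radical]

lemma koszulAcyclic_of_radical_eq_maximalIdeal (hCM : IsCohenMacaulayLocal R)
    (hdim : ringKrullDim R = 3) {u v w : R}
    (h : (Ideal.span {u, v, w}).radical = maximalIdeal R) : KoszulAcyclic u v w R := by
  have := hCM.1
  have hdepth : ((3 : ℕ) : ℕ∞) ≤ localDepth R R :=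
    (WithBot.coe_injective (hCM.2.trans hdim)).ge
  obtain ⟨rs, hlen, hmem, hrs⟩ := exists_isRegular_mem_of_le_localDepth hdepth h
  obtain ⟨r₁, r₂, r₃, rfl⟩ := List.length_eq_three.mp hlen
  exact koszulAcyclic_of_isWeaklyRegular hrs.1 (hmem r₁ (by simp)) (hmem r₂ (by simp))
    (hmem r₃ (by simp))

end CohenMacaulay

section RegularModuloIdeal

variable {R : Type*} [CommRing R] {J : Ideal R} {r s : R}

lemma mem_sup_span_singleton_iff {m : R} :
    m ∈ J ⊔ Ideal.span {r} ↔ ∃ n, m - r * n ∈ J := by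
  rw [sup_comm, Ideal.mem_span_singleton_sup]
  constructor
  · rintro ⟨n, j, hj, rfl⟩
    exact ⟨n, by rwa [mul_comm, add_sub_cancel_left]⟩
  · rintro ⟨n, hn⟩
    exact ⟨n, _, hn, by ring⟩

lemma isSMulRegular_quotient_sup_span_singleton (hr : IsSMulRegular (R ⧸ J) r)
    (hs : IsSMulRegular (R ⧸ J ⊔ Ideal.span {r}) s) :
    IsSMulRegular (R ⧸ J ⊔ Ideal.span {s}) r := by
  simp only [isSMulRegular_quotient_iff_mem_of_smul_mem, mem_sup_span_singleton_iff,
    smul_eq_mul] at *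
  rintro m ⟨n, hn⟩
  obtain ⟨n', hn'⟩ := hs n ⟨m, by rw [← neg_sub]; exact neg_mem hn⟩
  refine ⟨n', hr _ ?_⟩
  rw [show r * (m - s * n') = r * m - s * n + s * (n - r * n') by ring]
  exact add_mem hn (J.mul_mem_left s hn')

end RegularModuloIdeal

open MvPolynomial

section LinearForm

variable {R ι : Type*} [CommRing R]

lemma homogeneousComponent_mul_of_isHomogeneous {i : ℕ} {a : MvPolynomial ι R}
    (ha : a.IsHomogeneous i) (j : ℕ) (b : MvPolynomial ι R) :
    homogeneousComponent (i + j) (a * b) = a * homogeneousComponent j b :=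
  letI := MvPolynomial.gradedAlgebra (σ := ι) (R := R)
  have decompose_eq (φ : MvPolynomial ι R) k :
      (DirectSum.decompose (homogeneousSubmodule ι R) φ k : MvPolynomial ι R) =
        homogeneousComponent k φ := decomposition.decompose'_apply φ k
  decompose_eq (a * b) (i + j) ▸ decompose_eq b j ▸
    DirectSum.coe_decompose_mul_add_of_left_mem (homogeneousSubmodule ι R) ha

lemma isSMulRegular_C_quotient_map_C {K : Ideal R} {r : R} (h : IsSMulRegular (R ⧸ K) r) :
    IsSMulRegular (MvPolynomial ι R ⧸ K.map C) (C r : MvPolynomial ι R) := by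
  simp only [isSMulRegular_quotient_iff_mem_of_smul_mem, mem_map_C_iff, smul_eq_mul,
    coeff_C_mul] at h ⊢
  exact fun t ht m => h _ (ht m)

lemma homogeneousComponent_mem_map_C {K : Ideal R} {t : MvPolynomial ι R} (ht : t ∈ K.map C)
    (n : ℕ) : homogeneousComponent n t ∈ K.map (C : R →+* MvPolynomial ι R) := by
  rw [mem_map_C_iff] at ht ⊢
  intro m
  rw [coeff_homogeneousComponent]
  split_ifs
  exacts [ht m, K.zero_mem]

lemma aeval_smul_of_isHomogeneous {S : Type*} [CommRing S] [Algebra R S] {n : ℕ}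
    {F : MvPolynomial ι R} (hF : F.IsHomogeneous n) (c : S) (u : ι → S) :
    aeval (c • u) F = c ^ n * aeval u F := by
  simp only [aeval_def, eval₂_eq, Finset.mul_sum]
  refine Finset.sum_congr rfl fun d hd => ?_
  rw [hF.degree_eq_sum_deg_support hd]
  simp only [Pi.smul_apply, smul_eq_mul, mul_pow, Finset.prod_mul_distrib,
    Finset.prod_pow_eq_pow_sum]
  ring

lemma pow_mul_aeval_sub_pow_mul_aeval_mem {S : Type*} [CommRing S] [Algebra R S] {n : ℕ}
    {F : MvPolynomial ι R} (hF : F.IsHomogeneous n) {J : Ideal S} {c d : S} {u v : ι → S}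
    (h : ∀ i, c * u i - d * v i ∈ J) : c ^ n * aeval u F - d ^ n * aeval v F ∈ J := by
  rw [← aeval_smul_of_isHomogeneous hF, ← aeval_smul_of_isHomogeneous hF, ← Ideal.Quotient.eq,
    ← Ideal.Quotient.mkₐ_eq_mk R, comp_aeval_apply, comp_aeval_apply]
  congr 2
  funext i
  exact Ideal.Quotient.eq.mpr (h i)

variable [Fintype ι]

/-- The linear form with a given vector of coefficients. -/
noncomputable def linearForm : (ι → R) →ₗ[R] MvPolynomial ι R :=
  Fintype.linearCombination R X

lemma linearForm_apply (a : ι → R) : linearForm a = ∑ i, C (a i) * X i := by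
  simp only [linearForm, Fintype.linearCombination_apply, smul_eq_C_mul]

lemma isHomogeneous_linearForm (a : ι → R) : (linearForm a).IsHomogeneous 1 := by
  rw [linearForm_apply]
  exact .sum _ _ _ fun i _ => isHomogeneous_C_mul_X _ _

lemma aeval_linearForm {S : Type*} [CommRing S] [Algebra R S] (u : ι → S) (a : ι → R) :
    aeval u (linearForm a) = ∑ i, algebraMap R S (a i) * u i := by
  simp only [linearForm_apply, map_sum, map_mul, aeval_C, aeval_X]

lemma isSMulRegular_linearForm {K : Ideal R} {a : ι → R} {i : ι}
    (h : IsSMulRegular (R ⧸ K) (a i)) :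
    IsSMulRegular (MvPolynomial ι R ⧸ K.map C) (linearForm a) := by
  classical
  refine (isSMulRegular_quotient_iff_mem_of_smul_mem _ _).mpr fun t ht => ?_
  by_contra htK
  simp only [mem_map_C_iff, not_forall] at htK
  obtain ⟨m₀, hm₀⟩ := htK
  obtain ⟨m, hm, hmax⟩ := (t.support.filter (coeff · t ∉ K)).exists_max_image (· i) ⟨m₀, by
    simpa using ⟨fun h0 => hm₀ (h0 ▸ K.zero_mem), hm₀⟩⟩
  have coeff_mem {k : ι →₀ ℕ} (hk : m i < k i) : coeff k t ∈ K := by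
    by_contra hkK
    refine (hmax k ?_).not_gt hk
    simpa using ⟨fun h0 => hkK (h0 ▸ K.zero_mem), hkK⟩
  refine (Finset.mem_filter.mp hm).2 <|
    mem_of_isSMulRegular_quotient_of_smul_mem h (?_ : a i * coeff m t ∈ K)
  have hsum := mem_map_C_iff.mp ht (m + Finsupp.single i 1)
  rw [smul_eq_mul, linearForm_apply, Finset.sum_mul, coeff_sum,
    ← Finset.add_sum_erase _ _ (Finset.mem_univ i)] at hsum
  rw [mul_assoc, coeff_C_mul, add_comm m, coeff_X_mul] at hsum
  refine (K.add_mem_iff_left (sum_mem fun j hj => ?_)).mp hsum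
  rw [mul_assoc, coeff_C_mul, coeff_X_mul']
  split_ifs
  · refine K.mul_mem_left _ (coeff_mem ?_)
    simp [Finsupp.single_eq_of_ne (Finset.ne_of_mem_erase hj).symm]
  · simp

end LinearForm

section ReesEquations

open Matrix

variable {R : Type*} [CommRing R] {a b : Fin 3 → R} {K : Ideal R}

lemma isSMulRegular_C_quotient_sup_span_linearForm {ι : Type*} [Fintype ι] {a : ι → R} {i : ι}
    {r : R} (hr : IsSMulRegular (R ⧸ K) r) (ha : IsSMulRegular (R ⧸ K ⊔ Ideal.span {r}) (a i)) :
    IsSMulRegular (MvPolynomial ι R ⧸ K.map C ⊔ Ideal.span {linearForm a})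
      (C r : MvPolynomial ι R) := by
  have hf := isSMulRegular_linearForm ha
  rw [Ideal.map_sup, Ideal.map_span, Set.image_singleton] at hf
  exact isSMulRegular_quotient_sup_span_singleton (isSMulRegular_C_quotient_map_C hr) hf

lemma mem_sup_span_linearForm_of_isHomogeneous (ha₀ : IsSMulRegular (R ⧸ K) (a 0))
    (ha₂ : IsSMulRegular (R ⧸ K ⊔ Ideal.span {a 0}) (a 2))
    (hab : IsSMulRegular (R ⧸ K) ((a ⨯₃ b) 1)) {n : ℕ} {t : MvPolynomial (Fin 3) R}
    (ht : t.IsHomogeneous n) (hbt : linearForm b * t ∈ K.map C ⊔ Ideal.span {linearForm a}) :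
    t ∈ K.map C ⊔ Ideal.span {linearForm a} := by
  -- a parametrization of the plane `f = 0`, valid where `a 0` is invertible
  let u : Fin 3 → MvPolynomial (Fin 3) R :=
    ![C (a 1) * X 1 + C (a 2) * X 2, -(C (a 0) * X 1), -(C (a 0) * X 2)]
  have aeval_a : aeval u (linearForm a) = 0 := by
    rw [aeval_linearForm, Fin.sum_univ_three]
    simp only [algebraMap_eq, u, cons_val]
    ring
  have aeval_b : aeval u (linearForm b) = linearForm ![0, -(a ⨯₃ b) 2, (a ⨯₃ b) 1] := by
    rw [aeval_linearForm, linearForm_apply, Fin.sum_univ_three, Fin.sum_univ_three]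
    simp only [algebraMap_eq, u, cross_apply, cons_val, map_zero, map_neg, map_sub, map_mul]
    ring
  have aeval_mem {s : MvPolynomial (Fin 3) R} (hs : s ∈ K.map C ⊔ Ideal.span {linearForm a}) :
      aeval u s ∈ K.map (C : R →+* MvPolynomial (Fin 3) R) := by
    suffices hle : K.map C ⊔ Ideal.span {linearForm a} ≤ (K.map C).comap (aeval u) from hle hs
    refine sup_le (Ideal.map_le_iff_le_comap.mpr fun r hr => ?_) ?_
    · simpa [algebraMap_eq] using Ideal.mem_map_of_mem C hr
    · rw [Ideal.span_singleton_le_iff_mem, Ideal.mem_comap, aeval_a]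
      exact zero_mem _
  have aeval_t : aeval u t ∈ K.map (C : R →+* MvPolynomial (Fin 3) R) := by
    refine mem_of_isSMulRegular_quotient_of_smul_mem
      (isSMulRegular_linearForm (i := 2) (a := ![0, -(a ⨯₃ b) 2, (a ⨯₃ b) 1]) ?_) ?_
    · exact hab
    · rw [smul_eq_mul, ← aeval_b, ← map_mul]
      exact aeval_mem hbt
  have hpow := pow_mul_aeval_sub_pow_mul_aeval_mem ht (c := -1) (d := C (a 0)) (u := u) (v := X)
    (J := K.map C ⊔ Ideal.span {linearForm a}) fun i => by
      refine Ideal.mem_sup_right (Ideal.mem_span_singleton'.mpr ⟨if i = 0 then -1 else 0, ?_⟩)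
      fin_cases i <;> simp [u, linearForm_apply, Fin.sum_univ_three]
      ring
  rw [aeval_X_left_apply, Submodule.sub_mem_iff_right _
    (Ideal.mul_mem_left _ _ (Ideal.mem_sup_left aeval_t))] at hpow
  exact mem_of_isSMulRegular_quotient_of_smul_mem
    ((isSMulRegular_C_quotient_sup_span_linearForm ha₀ ha₂).pow n) hpow

lemma isSMulRegular_linearForm_quotient_sup_span_linearForm (ha₀ : IsSMulRegular (R ⧸ K) (a 0))
    (ha₂ : IsSMulRegular (R ⧸ K ⊔ Ideal.span {a 0}) (a 2))
    (hab : IsSMulRegular (R ⧸ K) ((a ⨯₃ b) 1)) :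
    IsSMulRegular (MvPolynomial (Fin 3) R ⧸ K.map C ⊔ Ideal.span {linearForm a})
      (linearForm b) := by
  refine (isSMulRegular_quotient_iff_mem_of_smul_mem _ _).mpr fun t ht => ?_
  obtain ⟨s, hs⟩ := mem_sup_span_singleton_iff.mp ht
  rw [← sum_homogeneousComponent t]
  refine sum_mem fun n _ => mem_sup_span_linearForm_of_isHomogeneous ha₀ ha₂ hab
    (homogeneousComponent_isHomogeneous n t) <| mem_sup_span_singleton_iff.mpr
      ⟨homogeneousComponent n s, ?_⟩
  rw [← homogeneousComponent_mul_of_isHomogeneous (isHomogeneous_linearForm b),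
    ← homogeneousComponent_mul_of_isHomogeneous (isHomogeneous_linearForm a), ← map_sub]
  exact homogeneousComponent_mem_map_C hs _

/-- A `2 × 3` matrix with rows `a` and `b` over a local ring that is general enough for the linear
forms `f` and `g` of its rows to be a regular sequence generating the kernel of the map from the
polynomial ring onto the Rees algebra of the ideal of maximal minors. The minors are the entries of
`a ⨯₃ b`. -/
structure IsRegularMatrix [IsLocalRing R] (a b : Fin 3 → R) : Prop where
  mem_maximalIdeal : ∀ i, a i ∈ maximalIdeal R
  koszulAcyclic_entry : KoszulAcyclic ((a ⨯₃ b) 2) (a 0) (a 2) R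
  koszulAcyclic_minor : KoszulAcyclic ((a ⨯₃ b) 2) ((a ⨯₃ b) 1) (a 2) R

lemma isSMulRegular_quotient_bot_iff {r : R} :
    IsSMulRegular (R ⧸ (⊥ : Ideal R)) r ↔ IsSMulRegular R r :=
  (Submodule.quotEquivOfEqBot ⊥ rfl).isSMulRegular_congr r

namespace IsRegularMatrix

variable [IsLocalRing R]

lemma minor_mem_maximalIdeal (h : IsRegularMatrix a b) (i : Fin 3) :
    (a ⨯₃ b) i ∈ maximalIdeal R := by
  have hmul (j k) : a j * b k ∈ maximalIdeal R := Ideal.mul_mem_right _ _ (h.mem_maximalIdeal j)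
  fin_cases i <;> exact sub_mem (hmul _ _) (hmul _ _)

variable [IsNoetherianRing R]

lemma isSMulRegular_entry (h : IsRegularMatrix a b) : IsSMulRegular R (a 0) :=
  h.koszulAcyclic_entry.rotate.isSMulRegular (h.mem_maximalIdeal 2) (h.minor_mem_maximalIdeal 2)

lemma isSMulRegular_linearForm_fst (h : IsRegularMatrix a b) :
    IsSMulRegular (MvPolynomial (Fin 3) R) (linearForm a) := by
  have := isSMulRegular_linearForm (isSMulRegular_quotient_bot_iff.mpr h.isSMulRegular_entry)
  rwa [Ideal.map_bot, isSMulRegular_quotient_bot_iff] at this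

lemma isSMulRegular_linearForm_snd (h : IsRegularMatrix a b) :
    IsSMulRegular (MvPolynomial (Fin 3) R ⧸ Ideal.span {linearForm a}) (linearForm b) := by
  have ha₂ := h.koszulAcyclic_entry.rotate.isSMulRegular_quotient_span_singleton
    (h.minor_mem_maximalIdeal 2)
  have hc₁ := h.koszulAcyclic_minor.rotate.isSMulRegular (h.mem_maximalIdeal 2)
    (h.minor_mem_maximalIdeal 2)
  have := isSMulRegular_linearForm_quotient_sup_span_linearForm (K := ⊥)
    (isSMulRegular_quotient_bot_iff.mpr h.isSMulRegular_entry) (by rwa [bot_sup_eq])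
    (isSMulRegular_quotient_bot_iff.mpr hc₁)
  rwa [Ideal.map_bot, bot_sup_eq] at this

lemma isSMulRegular_C_minor (h : IsRegularMatrix a b) :
    IsSMulRegular (MvPolynomial (Fin 3) R ⧸ Ideal.span {linearForm a} ⊔ Ideal.span {linearForm b})
      (C ((a ⨯₃ b) 2) : MvPolynomial (Fin 3) R) := by
  have hc := h.koszulAcyclic_entry.isSMulRegular (h.mem_maximalIdeal 0) (h.mem_maximalIdeal 2)
  have ha₀ := h.koszulAcyclic_entry.isSMulRegular_quotient_span_singleton (h.mem_maximalIdeal 2)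
  have ha₂ := h.koszulAcyclic_entry.isSMulRegular_quotient_span_pair
  have hc₁ := h.koszulAcyclic_minor.isSMulRegular_quotient_span_singleton (h.mem_maximalIdeal 2)
  have hf := isSMulRegular_C_quotient_sup_span_linearForm (K := ⊥) (a := a) (i := 0)
    (isSMulRegular_quotient_bot_iff.mpr hc) (by rwa [bot_sup_eq])
  rw [Ideal.span_insert] at ha₂
  have hg := isSMulRegular_linearForm_quotient_sup_span_linearForm ha₀ ha₂ hc₁
  rw [Ideal.map_bot, bot_sup_eq] at hf
  rw [Ideal.map_span, Set.image_singleton, sup_comm] at hg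
  exact isSMulRegular_quotient_sup_span_singleton hf hg

lemma exists_of_mul_add_mul_eq_zero (h : IsRegularMatrix a b) {n : ℕ}
    {s t : MvPolynomial (Fin 3) R} (hs : s.IsHomogeneous (1 + n)) (ht : t.IsHomogeneous (1 + n))
    (hst : linearForm a * s + linearForm b * t = 0) :
    ∃ r, r.IsHomogeneous n ∧ s = linearForm b * r ∧ t = -(linearForm a * r) := by
  obtain ⟨r, rfl⟩ := Ideal.mem_span_singleton'.mp <|
    mem_of_isSMulRegular_quotient_of_smul_mem (x := t) h.isSMulRegular_linearForm_snd
      (Ideal.mem_span_singleton'.mpr ⟨-s, by rw [smul_eq_mul]; linear_combination -hst⟩)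
  obtain rfl : s = -(linearForm b * r) := h.isSMulRegular_linearForm_fst <| by
    simp only [smul_eq_mul]; linear_combination hst
  refine ⟨-homogeneousComponent n r, (homogeneousComponent_isHomogeneous n r).neg, ?_, ?_⟩
  · rw [← homogeneousComponent_eq_self hs, map_neg,
      homogeneousComponent_mul_of_isHomogeneous (isHomogeneous_linearForm b), mul_neg]
  · rw [← homogeneousComponent_eq_self ht, mul_comm,
      homogeneousComponent_mul_of_isHomogeneous (isHomogeneous_linearForm a), mul_neg, neg_neg]

omit [IsLocalRing R] [IsNoetherianRing R] in
lemma C_minor_mul_X_sub_mem (a b : Fin 3 → R) (i : Fin 3) :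
    C ((a ⨯₃ b) 2) * X i - X 2 * C ((a ⨯₃ b) i) ∈
      Ideal.span {linearForm a} ⊔ Ideal.span {linearForm b} := by
  rw [← Ideal.span_insert, Ideal.mem_span_pair]
  refine ⟨C (![b 1, -b 0, 0] i), C (![-a 1, a 0, 0] i), ?_⟩
  simp only [linearForm_apply, Fin.sum_univ_three, cross_apply]
  fin_cases i <;> simp <;> ring

lemma exists_of_eval_minors_eq_zero (h : IsRegularMatrix a b) {n : ℕ}
    {F : MvPolynomial (Fin 3) R} (hF : F.IsHomogeneous (1 + n)) (hF₀ : eval (a ⨯₃ b) F = 0) :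
    ∃ s t, s.IsHomogeneous n ∧ t.IsHomogeneous n ∧ F = linearForm a * s + linearForm b * t := by
  have hpow := pow_mul_aeval_sub_pow_mul_aeval_mem (v := algebraMap R _ ∘ (a ⨯₃ b)) hF
    (C_minor_mul_X_sub_mem a b)
  rw [aeval_X_left_apply, aeval_algebraMap_apply,
    aeval_eq_eval, hF₀, map_zero, mul_zero, sub_zero] at hpow
  have hmem := mem_of_isSMulRegular_quotient_of_smul_mem (h.isSMulRegular_C_minor.pow _) hpow
  rw [← Ideal.span_insert, Ideal.mem_span_pair] at hmem
  obtain ⟨s, t, hst⟩ := hmem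
  refine ⟨_, _, homogeneousComponent_isHomogeneous n s, homogeneousComponent_isHomogeneous n t, ?_⟩
  rw [← homogeneousComponent_mul_of_isHomogeneous (isHomogeneous_linearForm a),
    ← homogeneousComponent_mul_of_isHomogeneous (isHomogeneous_linearForm b), ← map_add,
    mul_comm _ s, mul_comm _ t, hst, homogeneousComponent_eq_self hF]

end IsRegularMatrix

end ReesEquations

section FreeModules

variable {R M : Type*} [CommRing R] [AddCommGroup M] [Module R M] {u v w : R}

lemma KoszulAcyclic.of_free [Module.Free R M] [Module.Finite R M] (h : KoszulAcyclic u v w R) :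
    KoszulAcyclic u v w M := by
  let e := (Module.Free.chooseBasis R M).equivFun
  have coord {m m' : M} (hm : m = m') (i) : e m i = e m' i := by rw [hm]
  refine ⟨fun m₁ m₂ m₃ h₀ => ?_, fun m₁ m₂ m₃ h₁₂ h₁₃ h₂₃ => ?_, fun m hu hv hw => ?_⟩
  · choose n₁ n₂ n₃ hn₁ hn₂ hn₃ using fun i => h.one (e m₁ i) (e m₂ i) (e m₃ i) (by
      simpa using coord h₀ i)
    refine ⟨e.symm n₁, e.symm n₂, e.symm n₃, ?_, ?_, ?_⟩ <;>
      refine e.injective (funext fun i => ?_) <;> simp [hn₁, hn₂, hn₃]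
  · choose n hn₁ hn₂ hn₃ using fun i => h.two (e m₁ i) (e m₂ i) (e m₃ i)
      (by simpa using coord h₁₂ i) (by simpa using coord h₁₃ i) (by simpa using coord h₂₃ i)
    refine ⟨e.symm n, ?_, ?_, ?_⟩ <;>
      refine e.injective (funext fun i => ?_) <;> simp [hn₁, hn₂, hn₃]
  · refine e.injective (funext fun i => ?_)
    simpa using h.three (e m i) (by simpa using coord hu i) (by simpa using coord hv i)
      (by simpa using coord hw i)

variable (R) (σ : Type*) (n : ℕ)

lemma free_homogeneousSubmodule : Module.Free R (homogeneousSubmodule σ R n) := by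
  rw [homogeneousSubmodule_eq_finsupp_supported]
  exact .of_basis (basisRestrictSupport R _)

lemma finite_homogeneousSubmodule [Finite σ] : Module.Finite R (homogeneousSubmodule σ R n) :=
  Module.Finite.iff_fg.mpr (homogeneousSubmodule_fg σ R n)

end FreeModules

section ResidueRelation

lemma mem_span_triple_smul_top {R M : Type*} [CommRing R] [AddCommGroup M] [Module R M]
    {u v w : R} {m : M} : m ∈ Ideal.span {u, v, w} • (⊤ : Submodule R M) ↔
      ∃ n₁ n₂ n₃, m = u • n₁ + v • n₂ + w • n₃ := by
  simp only [Ideal.span_insert, Submodule.sup_smul, Submodule.ideal_span_singleton_smul,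
    Submodule.mem_sup, Submodule.mem_smul_pointwise_iff_exists, Submodule.mem_top, true_and]
  constructor
  · rintro ⟨_, ⟨n₁, rfl⟩, _, ⟨_, ⟨n₂, rfl⟩, _, ⟨n₃, rfl⟩, rfl⟩, rfl⟩
    exact ⟨n₁, n₂, n₃, by rw [add_assoc]⟩
  · rintro ⟨n₁, n₂, n₃, rfl⟩
    exact ⟨_, ⟨n₁, rfl⟩, _, ⟨_, ⟨n₂, rfl⟩, _, ⟨n₃, rfl⟩, rfl⟩, by rw [add_assoc]⟩

lemma nonempty_quotient_linearEquiv_of_relation {R M N : Type*} [CommRing R] [AddCommGroup M]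
    [Module R M] [AddCommGroup N] [Module R N] (Γ : Submodule R (M × N)) {M₀ M₁ : Submodule R M}
    {N₀ N₁ : Submodule R N} (hM : Γ.map (LinearMap.fst R M N) = M₁)
    (hN : Γ.map (LinearMap.snd R M N) = N₁) (h₀ : ∀ t ∈ Γ, t.1 ∈ M₀ ↔ t.2 ∈ N₀) :
    Nonempty ((M₁ ⧸ M₀.submoduleOf M₁) ≃ₗ[R] N₁ ⧸ N₀.submoduleOf N₁) := by
  subst hM hN
  let f := (M₀.submoduleOf _).mkQ ∘ₗ (LinearMap.fst R M N).submoduleMap Γ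
  let g := (N₀.submoduleOf _).mkQ ∘ₗ (LinearMap.snd R M N).submoduleMap Γ
  have hf : Function.Surjective f :=
    (Submodule.mkQ_surjective _).comp (LinearMap.submoduleMap_surjective _ Γ)
  have hg : Function.Surjective g :=
    (Submodule.mkQ_surjective _).comp (LinearMap.submoduleMap_surjective _ Γ)
  have hfg : LinearMap.ker f = LinearMap.ker g := by
    ext t
    simp only [f, g, LinearMap.ker_comp, Submodule.ker_mkQ, Submodule.mem_comap]
    exact h₀ t t.2
  exact ⟨(f.quotKerEquivOfSurjective hf).symm ≪≫ₗ Submodule.quotEquivOfEq _ _ hfg ≪≫ₗ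
    g.quotKerEquivOfSurjective hg⟩

variable {R : Type*} [CommRing R] {F₀ F₁ F₂ F₃ : Type*}
  [AddCommGroup F₀] [Module R F₀] [AddCommGroup F₁] [Module R F₁]
  [AddCommGroup F₂] [Module R F₂] [AddCommGroup F₃] [Module R F₃]

/-- The zigzag, in the double complex of a complex `F₃ → F₂ → F₁ → F₀` with the Koszul complex of
`u, v, w`, between the elements `τ` of `F₀` and `h` of `F₃`. If the complex is a resolution of `N`
by free modules over which `u, v, w` is Koszul acyclic, it identifies the annihilator of `u, v, w`
in `N` with `Tor₃ (R ⧸ (u, v, w)) N`, computed from either side. -/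
def residueRelation (u v w : R) (d₁ : F₁ →ₗ[R] F₀) (d₂ : F₂ →ₗ[R] F₁) (d₃ : F₃ →ₗ[R] F₂) :
    Submodule R (F₀ × F₃) where
  carrier := {t | ∃ s₁ s₂ s₃ a₁ a₂ a₃, u • t.1 = d₁ s₁ ∧ v • t.1 = d₁ s₂ ∧ w • t.1 = d₁ s₃ ∧
    d₂ a₁ = v • s₃ - w • s₂ ∧ d₂ a₂ = w • s₁ - u • s₃ ∧ d₂ a₃ = u • s₂ - v • s₁ ∧
    d₃ t.2 = u • a₁ + v • a₂ + w • a₃}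
  zero_mem' := ⟨0, 0, 0, 0, 0, 0, by simp⟩
  add_mem' := by
    rintro _ _ ⟨s₁, s₂, s₃, a₁, a₂, a₃, h⟩ ⟨s₁', s₂', s₃', a₁', a₂', a₃', h'⟩
    refine ⟨s₁ + s₁', s₂ + s₂', s₃ + s₃', a₁ + a₁', a₂ + a₂', a₃ + a₃', ?_⟩
    simp only [Prod.fst_add, Prod.snd_add, map_add, smul_add, add_sub_add_comm, h, h', true_and]
    abel
  smul_mem' := by
    rintro r _ ⟨s₁, s₂, s₃, a₁, a₂, a₃, h⟩
    refine ⟨r • s₁, r • s₂, r • s₃, r • a₁, r • a₂, r • a₃, ?_⟩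
    simp only [Prod.smul_fst, Prod.smul_snd, map_smul, smul_comm _ r, ← smul_sub, ← smul_add, h,
      true_and]

variable {u v w : R} {d₁ : F₁ →ₗ[R] F₀} {d₂ : F₂ →ₗ[R] F₁} {d₃ : F₃ →ₗ[R] F₂}

lemma exists_mem_residueRelation_of_smul_mem (h₁ : Function.Exact d₂ d₁)
    (h₂ : Function.Exact d₃ d₂) {τ : F₀} (hu : u • τ ∈ LinearMap.range d₁)
    (hv : v • τ ∈ LinearMap.range d₁) (hw : w • τ ∈ LinearMap.range d₁) :
    ∃ h, (τ, h) ∈ residueRelation u v w d₁ d₂ d₃ := by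
  obtain ⟨s₁, hs₁⟩ := hu
  obtain ⟨s₂, hs₂⟩ := hv
  obtain ⟨s₃, hs₃⟩ := hw
  obtain ⟨a₁, ha₁⟩ := (h₁ (v • s₃ - w • s₂)).mp (by simp only [map_sub, map_smul, *]; module)
  obtain ⟨a₂, ha₂⟩ := (h₁ (w • s₁ - u • s₃)).mp (by simp only [map_sub, map_smul, *]; module)
  obtain ⟨a₃, ha₃⟩ := (h₁ (u • s₂ - v • s₁)).mp (by simp only [map_sub, map_smul, *]; module)
  obtain ⟨h, hh⟩ := (h₂ (u • a₁ + v • a₂ + w • a₃)).mp (by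
    simp only [map_add, map_smul, ha₁, ha₂, ha₃]; module)
  exact ⟨h, s₁, s₂, s₃, a₁, a₂, a₃, hs₁.symm, hs₂.symm, hs₃.symm, ha₁, ha₂, ha₃, hh⟩

lemma exists_mem_residueRelation_of_eq (h₁ : Function.Exact d₂ d₁) (h₂ : Function.Exact d₃ d₂)
    (hF₀ : KoszulAcyclic u v w F₀) (hF₁ : KoszulAcyclic u v w F₁) {h : F₃} {a₁ a₂ a₃ : F₂}
    (hh : d₃ h = u • a₁ + v • a₂ + w • a₃) :
    ∃ τ, (τ, h) ∈ residueRelation u v w d₁ d₂ d₃ := by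
  obtain ⟨s₁, s₂, s₃, e₁, e₂, e₃⟩ := hF₁.one (d₂ a₁) (d₂ a₂) (d₂ a₃) (by
    simp only [← map_smul, ← map_add, ← hh, h₂.apply_apply_eq_zero])
  have cocycle {a b : R} {s t : F₁} {c : F₂} (e : d₂ c = a • s - b • t) : b • d₁ t = a • d₁ s := by
    rw [← map_smul, ← map_smul, eq_comm, ← sub_eq_zero, ← map_sub, ← e, h₁.apply_apply_eq_zero]
  obtain ⟨τ, t₁, t₂, t₃⟩ := hF₀.two (d₁ s₁) (d₁ s₂) (d₁ s₃)
    (cocycle e₃) (cocycle e₂).symm (cocycle e₁)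
  exact ⟨τ, s₁, s₂, s₃, a₁, a₂, a₃, t₁.symm, t₂.symm, t₃.symm, e₁, e₂, e₃, hh⟩

lemma exists_eq_of_mem_residueRelation_of_mem_range (h₁ : Function.Exact d₂ d₁)
    (h₂ : Function.Exact d₃ d₂) (h₃ : Function.Injective d₃) {τ : F₀} {h : F₃}
    (hτ : (τ, h) ∈ residueRelation u v w d₁ d₂ d₃) (hmem : τ ∈ LinearMap.range d₁) :
    ∃ k₁ k₂ k₃, h = u • k₁ + v • k₂ + w • k₃ := by
  obtain ⟨s₁, s₂, s₃, a₁, a₂, a₃, t₁, t₂, t₃, e₁, e₂, e₃, hh⟩ := hτ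
  obtain ⟨σ, rfl⟩ := hmem
  have lift {c : R} {s : F₁} (hs : c • d₁ σ = d₁ s) : ∃ b, d₂ b = s - c • σ :=
    (h₁ _).mp (by rw [map_sub, map_smul, hs, sub_self])
  obtain ⟨b₁, hb₁⟩ := lift t₁
  obtain ⟨b₂, hb₂⟩ := lift t₂
  obtain ⟨b₃, hb₃⟩ := lift t₃
  obtain ⟨k₁, hk₁⟩ := (h₂ (a₁ - (v • b₃ - w • b₂))).mp (by
    simp only [map_sub, map_smul, e₁, hb₂, hb₃]; module)
  obtain ⟨k₂, hk₂⟩ := (h₂ (a₂ - (w • b₁ - u • b₃))).mp (by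
    simp only [map_sub, map_smul, e₂, hb₁, hb₃]; module)
  obtain ⟨k₃, hk₃⟩ := (h₂ (a₃ - (u • b₂ - v • b₁))).mp (by
    simp only [map_sub, map_smul, e₃, hb₁, hb₂]; module)
  refine ⟨k₁, k₂, k₃, h₃ ?_⟩
  simp only [hh, map_add, map_smul, hk₁, hk₂, hk₃]
  module

lemma mem_range_of_mem_residueRelation (h₁ : Function.Exact d₂ d₁) (h₂ : Function.Exact d₃ d₂)
    (hF₀ : KoszulAcyclic u v w F₀) (hF₁ : KoszulAcyclic u v w F₁) (hF₂ : KoszulAcyclic u v w F₂)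
    {τ : F₀} {k₁ k₂ k₃ : F₃}
    (hτ : (τ, u • k₁ + v • k₂ + w • k₃) ∈ residueRelation u v w d₁ d₂ d₃) :
    τ ∈ LinearMap.range d₁ := by
  obtain ⟨s₁, s₂, s₃, a₁, a₂, a₃, t₁, t₂, t₃, e₁, e₂, e₃, hh⟩ := hτ
  simp only [map_add, map_smul] at t₁ t₂ t₃ hh
  obtain ⟨b₁, b₂, b₃, f₁, f₂, f₃⟩ := hF₂.one (a₁ - d₃ k₁) (a₂ - d₃ k₂) (a₃ - d₃ k₃) (by
    linear_combination (norm := module) -hh)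
  have cycle {a b c : F₂} {k : F₃} {r r' : R} (e : a - d₃ k = r • b - r' • c) :
      d₂ a = r • d₂ b - r' • d₂ c := by
    rw [← map_smul, ← map_smul, ← map_sub, ← e, map_sub, h₂.apply_apply_eq_zero, sub_zero]
  obtain ⟨σ, hσ₁, hσ₂, hσ₃⟩ := hF₁.two (s₁ - d₂ b₁) (s₂ - d₂ b₂) (s₃ - d₂ b₃)
    (by linear_combination (norm := module) e₃ - cycle f₃)
    (by linear_combination (norm := module) cycle f₂ - e₂)
    (by linear_combination (norm := module) e₁ - cycle f₁)
  have eq_d₁ {r : R} {s : F₁} {b : F₂} (t : r • τ = d₁ s) (hσ : s - d₂ b = r • σ) :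
      r • (d₁ σ - τ) = 0 := by
    rw [smul_sub, t, ← map_smul, ← hσ, map_sub, h₁.apply_apply_eq_zero, sub_zero, sub_self]
  exact ⟨σ, sub_eq_zero.mp (hF₀.three _ (eq_d₁ t₁ hσ₁) (eq_d₁ t₂ hσ₂) (eq_d₁ t₃ hσ₃))⟩

theorem nonempty_residue_linearEquiv (h₁ : Function.Exact d₂ d₁) (h₂ : Function.Exact d₃ d₂)
    (h₃ : Function.Injective d₃) (hF₀ : KoszulAcyclic u v w F₀) (hF₁ : KoszulAcyclic u v w F₁)
    (hF₂ : KoszulAcyclic u v w F₂) {N : Submodule R F₀} (hN : ∀ τ, τ ∈ N ↔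
      u • τ ∈ LinearMap.range d₁ ∧ v • τ ∈ LinearMap.range d₁ ∧ w • τ ∈ LinearMap.range d₁) :
    Nonempty ((N ⧸ (LinearMap.range d₁).submoduleOf N) ≃ₗ[R]
      (Ideal.span {u, v, w} • (⊤ : Submodule R F₂)).comap d₃ ⧸
        (Ideal.span {u, v, w} • (⊤ : Submodule R F₃)).submoduleOf
          ((Ideal.span {u, v, w} • (⊤ : Submodule R F₂)).comap d₃)) := by
  refine nonempty_quotient_linearEquiv_of_relation (residueRelation u v w d₁ d₂ d₃) ?_ ?_ ?_
  · ext τ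
    simp only [Submodule.mem_map, LinearMap.fst_apply, Prod.exists, exists_and_right,
      exists_eq_right, hN]
    refine ⟨?_, fun ⟨hu, hv, hw⟩ => exists_mem_residueRelation_of_smul_mem h₁ h₂ hu hv hw⟩
    rintro ⟨h, s₁, s₂, s₃, -, -, -, t₁, t₂, t₃, -⟩
    exact ⟨⟨s₁, t₁.symm⟩, ⟨s₂, t₂.symm⟩, ⟨s₃, t₃.symm⟩⟩
  · ext h
    simp only [Submodule.mem_map, LinearMap.snd_apply, Prod.exists, exists_eq_right,
      Submodule.mem_comap, mem_span_triple_smul_top]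
    refine ⟨?_, fun ⟨_, _, _, hh⟩ => exists_mem_residueRelation_of_eq h₁ h₂ hF₀ hF₁ hh⟩
    rintro ⟨τ, -, -, -, a₁, a₂, a₃, -, -, -, -, -, -, hh⟩
    exact ⟨a₁, a₂, a₃, hh⟩
  · rintro ⟨τ, h⟩ hτ
    rw [mem_span_triple_smul_top]
    refine ⟨exists_eq_of_mem_residueRelation_of_mem_range h₁ h₂ h₃ hτ, ?_⟩
    rintro ⟨k₁, k₂, k₃, rfl⟩
    exact mem_range_of_mem_residueRelation h₁ h₂ hF₀ hF₁ hF₂ hτ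

end ResidueRelation

section CubeResolution

open Matrix

variable {R M N : Type*} [CommRing R] [AddCommGroup M] [Module R M] [AddCommGroup N] [Module R N]

lemma mem_smul_top_prod_iff {J : Ideal R} {t : M × N} :
    t ∈ J • (⊤ : Submodule R (M × N)) ↔
      t.1 ∈ J • (⊤ : Submodule R M) ∧ t.2 ∈ J • (⊤ : Submodule R N) := by
  refine ⟨fun h => ⟨Submodule.smul_top_le_comap_smul_top J (LinearMap.fst R M N) h,
    Submodule.smul_top_le_comap_smul_top J (LinearMap.snd R M N) h⟩, fun ⟨h₁, h₂⟩ => ?_⟩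
  rw [← Prod.fst_add_snd t]
  exact add_mem (Submodule.smul_top_le_comap_smul_top J (LinearMap.inl R M N) h₁)
    (Submodule.smul_top_le_comap_smul_top J (LinearMap.inr R M N) h₂)

lemma mem_smul_top_pi_iff {ι : Type*} [Finite ι] {J : Ideal R} {h : ι → R} :
    h ∈ J • (⊤ : Submodule R (ι → R)) ↔ ∀ i, h i ∈ J := by
  classical
  have := Fintype.ofFinite ι
  refine ⟨fun hh i => ?_, fun hh => ?_⟩
  · simpa using Submodule.smul_top_le_comap_smul_top J (LinearMap.proj (R := R) i) hh
  · rw [pi_eq_sum_univ' h]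
    exact sum_mem fun i _ => Submodule.smul_mem_smul (hh i) Submodule.mem_top

lemma mem_smul_top_homogeneousSubmodule_iff {σ : Type*} {n : ℕ} {J : Ideal R}
    {t : homogeneousSubmodule σ R n} :
    t ∈ J • (⊤ : Submodule R (homogeneousSubmodule σ R n)) ↔ (t : MvPolynomial σ R) ∈ J.map C := by
  have mem_iff {s : MvPolynomial σ R} :
      s ∈ J • (⊤ : Submodule R (MvPolynomial σ R)) ↔ s ∈ J.map C := by
    rw [Ideal.smul_top_eq_map, Submodule.restrictScalars_mem, algebraMap_eq]
  rw [← mem_iff]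
  refine ⟨fun h => Submodule.smul_top_le_comap_smul_top J (Submodule.subtype _) h, fun h => ?_⟩
  let π := (homogeneousComponent n).codRestrict (homogeneousSubmodule σ R n)
    (homogeneousComponent_mem n)
  have hπ : π t = t := Subtype.ext (homogeneousComponent_eq_self t.2)
  exact hπ ▸ Submodule.smul_top_le_comap_smul_top J π h

/-- The coefficient vectors `h` for which the product of the linear forms with coefficients `ξ`
and `h` vanishes modulo `J`, expressed through twice the coefficients of the product. -/
def productKernel {ι : Type*} (J : Ideal R) (ξ : ι → R) : Submodule R (ι → R) where
  carrier := {h | ∀ i j, ξ i * h j + ξ j * h i ∈ J}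
  zero_mem' := by simp
  add_mem' {h k} hh hk i j := by
    convert add_mem (hh i j) (hk i j) using 1
    simp only [Pi.add_apply]
    ring
  smul_mem' r h hh i j := by
    convert J.mul_mem_left r (hh i j) using 1
    simp only [Pi.smul_apply, smul_eq_mul]
    ring

lemma mem_productKernel_iff_linearForm_mul_mem {ι : Type*} [Fintype ι] (h2 : IsUnit (2 : R))
    {J : Ideal R} {ξ h : ι → R} :
    h ∈ productKernel J ξ ↔ linearForm ξ * linearForm h ∈ J.map C := by
  classical
  constructor
  · intro hh
    have expand : C 2 * (linearForm ξ * linearForm h) =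
        ∑ i, ∑ j, X i * X j * C (ξ i * h j + ξ j * h i) := by
      have comm := Finset.sum_comm (s := Finset.univ) (t := Finset.univ)
        (f := fun i j => X i * X j * (C (ξ j) * C (h i) : MvPolynomial ι R))
      simp only [C_add, C_mul, mul_add, Finset.sum_add_distrib, comm]
      simp only [linearForm_apply, Finset.sum_mul_sum, map_ofNat, two_mul,
        ← Finset.sum_add_distrib]
      exact Finset.sum_congr rfl fun i _ => Finset.sum_congr rfl fun j _ => by ring
    rw [← Ideal.unit_mul_mem_iff_mem _ (h2.map C), expand]
    exact sum_mem fun i _ => sum_mem fun j _ =>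
      Ideal.mul_mem_left _ _ (Ideal.mem_map_of_mem C (hh i j))
  · intro hh i j
    have eval_mem (b : ι → R) : (∑ k, ξ k * b k) * ∑ k, h k * b k ∈ J := by
      have hle : J.map C ≤ J.comap (aeval b : MvPolynomial ι R →ₐ[R] R) :=
        Ideal.map_le_iff_le_comap.mpr fun r hr => by simpa using hr
      simpa only [Ideal.mem_comap, map_mul, aeval_linearForm, Algebra.algebraMap_self_apply]
        using hle hh
    have single_mem (k : ι) : ξ k * h k ∈ J := by
      simpa [Pi.single_apply] using eval_mem (Pi.single k 1)
    convert sub_mem (sub_mem (eval_mem (Pi.single i 1 + Pi.single j 1)) (single_mem i))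
      (single_mem j) using 1
    simp only [Pi.add_apply, mul_add, Finset.sum_add_distrib, Pi.single_apply, mul_ite, mul_one,
      mul_zero, Finset.sum_ite_eq', Finset.mem_univ, if_true]
    ring

variable {a b : Fin 3 → R}

/-- Multiplication by a linear form, from the forms of degree `n` to those of degree `1 + n`. -/
noncomputable def mulLinearForm (a : Fin 3 → R) (n : ℕ) :
    homogeneousSubmodule (Fin 3) R n →ₗ[R] homogeneousSubmodule (Fin 3) R (1 + n) :=
  (LinearMap.mulLeft R (linearForm a)).restrict fun _ hs => (isHomogeneous_linearForm a).mul hs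

/-- The last differential `S₁ → S₂ ⊕ S₂` of the degree `3` strand of the Koszul complex of the
linear forms with coefficients `a` and `b`, written on coefficient vectors. -/
noncomputable def diffThree (a b : Fin 3 → R) : (Fin 3 → R) →ₗ[R]
    homogeneousSubmodule (Fin 3) R 2 × homogeneousSubmodule (Fin 3) R 2 :=
  ((mulLinearForm b 1).prod (-mulLinearForm a 1)) ∘ₗ
    linearForm.codRestrict (homogeneousSubmodule (Fin 3) R 1) isHomogeneous_linearForm

/-- The differential `S₂ ⊕ S₂ → S₃` of the degree `3` strand of the Koszul complex of the linear
forms with coefficients `a` and `b`. -/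
noncomputable def diffTwo (a b : Fin 3 → R) :
    homogeneousSubmodule (Fin 3) R 2 × homogeneousSubmodule (Fin 3) R 2 →ₗ[R]
      homogeneousSubmodule (Fin 3) R 3 :=
  (mulLinearForm a 2).coprod (mulLinearForm b 2)

/-- The augmentation of the degree `3` strand: evaluation of the cubic forms at the maximal minors
of the matrix with rows `a` and `b`. -/
noncomputable def diffOne (a b : Fin 3 → R) : homogeneousSubmodule (Fin 3) R 3 →ₗ[R] R :=
  (aeval (a ⨯₃ b)).toLinearMap ∘ₗ Submodule.subtype _

lemma coe_diffThree_fst (h : Fin 3 → R) :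
    ((diffThree a b h).1 : MvPolynomial (Fin 3) R) = linearForm b * linearForm h := rfl

lemma coe_diffThree_snd (h : Fin 3 → R) :
    ((diffThree a b h).2 : MvPolynomial (Fin 3) R) = -(linearForm a * linearForm h) := rfl

lemma coe_diffTwo (s t : homogeneousSubmodule (Fin 3) R 2) :
    (diffTwo a b (s, t) : MvPolynomial (Fin 3) R) = linearForm a * s + linearForm b * t := rfl

/-- The ideal generated by the maximal minors of the `2 × 3` matrix with rows `a` and `b`: up to
sign these are the entries of the cross product. -/
def minorsIdeal (a b : Fin 3 → R) : Ideal R := Ideal.span (Set.range (a ⨯₃ b))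

lemma range_diffOne : LinearMap.range (diffOne a b) = minorsIdeal a b ^ 3 := by
  ext r
  rw [minorsIdeal, Ideal.mem_span_pow_iff_exists_isHomogeneous, LinearMap.mem_range]
  exact ⟨fun ⟨⟨s, hs⟩, h⟩ => ⟨s, hs, h⟩, fun ⟨s, hs, h⟩ => ⟨⟨s, hs⟩, h⟩⟩

lemma exists_eq_linearForm {ι : Type*} [Fintype ι] {s : MvPolynomial ι R}
    (hs : s.IsHomogeneous 1) : ∃ h : ι → R, s = linearForm h := by
  rw [← mem_homogeneousSubmodule, homogeneousSubmodule_one_eq_span_X,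
    Submodule.mem_span_range_iff_exists_fun] at hs
  obtain ⟨h, rfl⟩ := hs
  exact ⟨h, rfl⟩

lemma linearForm_injective {ι : Type*} [Fintype ι] :
    Function.Injective (linearForm : (ι → R) →ₗ[R] MvPolynomial ι R) := by
  classical
  intro h k e
  funext i
  simpa [aeval_linearForm, Pi.single_apply] using congrArg (aeval (Pi.single i (1 : R))) e

lemma comap_diffThree_smul_top (h2 : IsUnit (2 : R)) (J : Ideal R) :
    (J • (⊤ : Submodule R (_ × _))).comap (diffThree a b) =
      productKernel J a ⊓ productKernel J b := by
  ext h
  rw [Submodule.mem_comap, mem_smul_top_prod_iff, mem_smul_top_homogeneousSubmodule_iff,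
    mem_smul_top_homogeneousSubmodule_iff, coe_diffThree_fst, coe_diffThree_snd, neg_mem_iff,
    Submodule.mem_inf, mem_productKernel_iff_linearForm_mul_mem h2,
    mem_productKernel_iff_linearForm_mul_mem h2, and_comm]

namespace IsRegularMatrix

variable [IsLocalRing R] [IsNoetherianRing R]

lemma injective_diffThree (h : IsRegularMatrix a b) : Function.Injective (diffThree a b) := by
  refine (injective_iff_map_eq_zero _).mpr fun k hk => ?_
  have hk₂ : linearForm a * linearForm k = 0 := by
    rw [← neg_eq_zero, ← coe_diffThree_snd (b := b), hk]
    rfl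
  refine linearForm_injective (.trans ?_ (map_zero _).symm)
  exact h.isSMulRegular_linearForm_fst (by simpa using hk₂)

lemma exact_diffThree (h : IsRegularMatrix a b) :
    Function.Exact (diffThree a b) (diffTwo a b) := by
  rintro ⟨⟨s, hs⟩, ⟨t, ht⟩⟩
  constructor
  · intro e
    obtain ⟨r, hr, rfl, rfl⟩ := h.exists_of_mul_add_mul_eq_zero (n := 1) hs ht
      (congrArg Subtype.val e)
    obtain ⟨k, rfl⟩ := exists_eq_linearForm hr
    exact ⟨k, rfl⟩
  · rintro ⟨k, hk⟩
    rw [← hk]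
    refine Subtype.ext ?_
    rw [← Prod.mk.eta (p := diffThree a b k), coe_diffTwo, coe_diffThree_fst, coe_diffThree_snd,
      Submodule.coe_zero]
    ring

lemma exact_diffTwo (h : IsRegularMatrix a b) :
    Function.Exact (diffTwo a b) (diffOne a b) := by
  rintro ⟨F, hF⟩
  constructor
  · intro e
    obtain ⟨s, t, hs, ht, rfl⟩ := h.exists_of_eval_minors_eq_zero (n := 2) hF e
    exact ⟨(⟨s, hs⟩, ⟨t, ht⟩), rfl⟩
  · rintro ⟨⟨s, t⟩, hst⟩
    rw [← hst]
    have aeval_a : aeval (a ⨯₃ b) (linearForm a) = 0 :=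
      (aeval_linearForm _ a).trans (dot_self_cross a b)
    have aeval_b : aeval (a ⨯₃ b) (linearForm b) = 0 :=
      (aeval_linearForm _ b).trans (dot_cross_self a b)
    simp only [diffOne, LinearMap.comp_apply, Submodule.subtype_apply, coe_diffTwo,
      AlgHom.toLinearMap_apply, map_add, map_mul, aeval_a, aeval_b, zero_mul, add_zero]

theorem nonempty_colon_cube_quotient_linearEquiv (h : IsRegularMatrix a b) (h2 : IsUnit (2 : R))
    {u v w : R} (hK : KoszulAcyclic u v w R) {J : Ideal R} (hJ : J = Ideal.span {u, v, w}) :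
    Nonempty (((minorsIdeal a b ^ 3).colon (J : Set R) ⧸
        (minorsIdeal a b ^ 3).submoduleOf ((minorsIdeal a b ^ 3).colon (J : Set R))) ≃ₗ[R]
      ↥(productKernel J a ⊓ productKernel J b) ⧸ (J • (⊤ : Submodule R (Fin 3 → R))).submoduleOf
        (productKernel J a ⊓ productKernel J b)) := by
  have := free_homogeneousSubmodule R (Fin 3)
  have := finite_homogeneousSubmodule R (Fin 3)
  subst hJ
  rw [← comap_diffThree_smul_top h2, ← range_diffOne]
  refine nonempty_residue_linearEquiv h.exact_diffTwo h.exact_diffThree h.injective_diffThree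
    hK hK.of_free hK.of_free fun τ => ?_
  rw [Ideal.colon_span, Submodule.mem_colon]
  simp only [Set.mem_insert_iff, Set.mem_singleton_iff, forall_eq_or_imp, forall_eq, smul_eq_mul,
    mul_comm τ]

end IsRegularMatrix

end CubeResolution

section Length

variable {R M : Type*} [CommRing R] [AddCommGroup M] [Module R M]

lemma length_quotient_submoduleOf_add {L₀ L₁ L₂ : Submodule R M} (h₀ : L₀ ≤ L₁) (h₁ : L₁ ≤ L₂) :
    Module.length R (L₂ ⧸ L₀.submoduleOf L₂) =
      Module.length R (L₁ ⧸ L₀.submoduleOf L₁) + Module.length R (L₂ ⧸ L₁.submoduleOf L₂) := by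
  have le_comap : L₀.submoduleOf L₁ ≤ (L₀.submoduleOf L₂).comap (Submodule.inclusion h₁) :=
    fun _ h => h
  have le : L₀.submoduleOf L₂ ≤ L₁.submoduleOf L₂ := fun _ h => h₀ h
  refine Module.length_eq_add_of_exact (Submodule.mapQ _ _ (Submodule.inclusion h₁) le_comap)
    (Submodule.factor le) ?_ (Submodule.factor_surjective le) ?_
  · rw [← LinearMap.ker_eq_bot, Submodule.ker_mapQ]
    exact Submodule.mkQ_map_self _
  · rw [LinearMap.exact_iff, Submodule.range_mapQ, Submodule.range_inclusion]
    exact Submodule.ker_mapQ _ _ _ _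

lemma length_quotient_submoduleOf_of_linearMap {ι : Type*} [Fintype ι] (Q : Ideal R)
    (θ : (ι → R) →ₗ[R] M) {L K : Submodule R M} (hK : ∀ s, θ s ∈ K)
    (hs : ∀ k ∈ K, ∃ s, k - θ s ∈ L) (hL : ∀ s, θ s ∈ L ↔ ∀ i, s i ∈ Q) :
    Module.length R (K ⧸ L.submoduleOf K) = Fintype.card ι * Module.length R (R ⧸ Q) := by
  classical
  let f : (ι → R) →ₗ[R] K ⧸ L.submoduleOf K := (L.submoduleOf K).mkQ ∘ₗ θ.codRestrict K hK
  have hf : Function.Surjective f := by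
    intro k
    obtain ⟨k, rfl⟩ := Submodule.mkQ_surjective _ k
    obtain ⟨s, hs⟩ := hs k k.2
    exact ⟨s, Eq.symm ((Submodule.Quotient.eq (L.submoduleOf K)).mpr hs)⟩
  have hker : LinearMap.ker f = Submodule.pi Set.univ fun _ : ι => (Q : Submodule R R) := by
    ext s
    rw [LinearMap.ker_comp, Submodule.ker_mkQ, Submodule.mem_pi]
    exact (hL s).trans (by simp)
  rw [← (f.quotKerEquivOfSurjective hf).length_eq, hker,
    (Submodule.quotientPi fun _ : ι => (Q : Submodule R R)).length_eq,
    Module.length_pi_of_fintype]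
  simp

end Length

section ProductKernelSquares

open Matrix

variable {R : Type*} [CommRing R]

lemma mem_sup_span_singleton_of_mul_mem {J : Ideal R} {r s m : R} (hr : IsSMulRegular (R ⧸ J) r)
    (h : r * m ∈ J ⊔ Ideal.span {r * s}) : m ∈ J ⊔ Ideal.span {s} := by
  rw [mem_sup_span_singleton_iff] at h ⊢
  obtain ⟨n, hn⟩ := h
  refine ⟨n, mem_of_isSMulRegular_quotient_of_smul_mem hr ?_⟩
  rwa [smul_eq_mul, mul_sub, ← mul_assoc]

lemma span_triple_rotate (u v w : R) : Ideal.span {u, v, w} = Ideal.span {v, w, u} := by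
  rw [Set.insert_comm, Set.pair_comm]

/-- All positive powers of `x, y, z` are Koszul acyclic: the form in which systems of parameters
of a Cohen–Macaulay local ring of dimension `3` are used. -/
def PowersKoszulAcyclic (x y z : R) : Prop :=
  ∀ ⦃a b c : ℕ⦄, 0 < a → 0 < b → 0 < c → KoszulAcyclic (x ^ a) (y ^ b) (z ^ c) R

namespace PowersKoszulAcyclic

variable {x y z m : R}

lemma rotate (H : PowersKoszulAcyclic x y z) : PowersKoszulAcyclic y z x :=
  fun _ _ _ hb hc ha => (H ha hb hc).rotate

lemma mem_span_of_pow_mul_mem (H : PowersKoszulAcyclic x y z) (a d : ℕ) {b c : ℕ} (hb : 0 < b)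
    (hc : 0 < c) (h : x ^ d * m ∈ Ideal.span {x ^ (a + d), y ^ b, z ^ c}) :
    m ∈ Ideal.span {x ^ a, y ^ b, z ^ c} := by
  have hx : IsSMulRegular (R ⧸ Ideal.span {y ^ b, z ^ c}) x := by
    simpa using (H one_pos hb hc).rotate.isSMulRegular_quotient_span_pair
  rw [Ideal.span_insert, sup_comm] at h ⊢
  exact mem_sup_span_singleton_of_mul_mem (hx.pow d) (by rwa [← pow_add, add_comm])

lemma mem_span_of_monomial_mul_mem (H : PowersKoszulAcyclic x y z) {a b c : ℕ} (ha : 0 < a)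
    (hb : 0 < b) (hc : 0 < c) (d e f : ℕ)
    (h : x ^ d * y ^ e * z ^ f * m ∈ Ideal.span {x ^ (a + d), y ^ (b + e), z ^ (c + f)}) :
    m ∈ Ideal.span {x ^ a, y ^ b, z ^ c} := by
  rw [mul_assoc, mul_assoc] at h
  have hx := H.mem_span_of_pow_mul_mem a d (by omega) (by omega) h
  rw [span_triple_rotate] at hx
  have hy := H.rotate.mem_span_of_pow_mul_mem b e (by omega) ha hx
  rw [span_triple_rotate] at hy
  have hz := H.rotate.rotate.mem_span_of_pow_mul_mem c f ha hb hy
  rwa [span_triple_rotate] at hz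

end PowersKoszulAcyclic

variable {ξ : Fin 3 → R}

lemma span_range_fin_three (f : Fin 3 → R) (i : Fin 3) :
    Ideal.span (Set.range f) = Ideal.span {f i, f (i + 1), f (i + 2)} := by
  congr 1
  ext r
  fin_cases i <;> simp [Fin.exists_fin_succ, eq_comm] <;> tauto

lemma PowersKoszulAcyclic.shift (H : PowersKoszulAcyclic (ξ 0) (ξ 1) (ξ 2)) (i : Fin 3) :
    PowersKoszulAcyclic (ξ i) (ξ (i + 1)) (ξ (i + 2)) := by
  fin_cases i
  exacts [H, H.rotate, H.rotate.rotate]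

/-- The ideal generated by the squares of the entries of `ξ`. -/
def squaresIdeal (ξ : Fin 3 → R) : Ideal R := Ideal.span (Set.range fun i => ξ i ^ 2)

lemma squaresIdeal_eq (ξ : Fin 3 → R) (i : Fin 3) :
    squaresIdeal ξ = Ideal.span {ξ i ^ 2, ξ (i + 1) ^ 2, ξ (i + 2) ^ 2} :=
  span_range_fin_three _ i

lemma mem_squaresIdeal_of_eq {m : R} (i : Fin 3) (a b c : R)
    (h : m = a * ξ i ^ 2 + b * ξ (i + 1) ^ 2 + c * ξ (i + 2) ^ 2) : m ∈ squaresIdeal ξ := by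
  rw [squaresIdeal_eq ξ i]
  exact Submodule.mem_span_triple.mpr ⟨a, b, c, h.symm⟩

/-- The ideal generated by the squares of the entries of `ξ` and by their product. If the entries
form a regular sequence, it is the colon ideal of `squaresIdeal ξ` by the entries. -/
def squaresColonIdeal (ξ : Fin 3 → R) : Ideal R := squaresIdeal ξ ⊔ Ideal.span {∏ i, ξ i}

lemma prod_eq_mul_mul (ξ : Fin 3 → R) (i : Fin 3) : ∏ j, ξ j = ξ i * ξ (i + 1) * ξ (i + 2) := by
  rw [Fin.prod_univ_three]
  fin_cases i
  exacts [rfl, mul_rotate (ξ 0) (ξ 1) (ξ 2), (mul_rotate (ξ 2) (ξ 0) (ξ 1)).symm]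

lemma mem_squaresColonIdeal {m : R} (i : Fin 3) : m ∈ squaresColonIdeal ξ ↔
    ∃ n, m - ξ i * ξ (i + 1) * ξ (i + 2) * n ∈ squaresIdeal ξ := by
  rw [squaresColonIdeal, mem_sup_span_singleton_iff, prod_eq_mul_mul ξ i]

lemma mul_mem_squaresIdeal (i : Fin 3) {m : R} (hm : m ∈ squaresColonIdeal ξ) :
    ξ i * m ∈ squaresIdeal ξ := by
  obtain ⟨n, hn⟩ := (mem_squaresColonIdeal i).mp hm
  rw [← sub_add_cancel m (ξ i * ξ (i + 1) * ξ (i + 2) * n), mul_add]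
  exact add_mem (Ideal.mul_mem_left _ _ hn)
    (mem_squaresIdeal_of_eq i (ξ (i + 1) * ξ (i + 2) * n) 0 0 (by ring))

lemma prod_mul_mem_squaresIdeal {m : R} (hm : m ∈ Ideal.span (Set.range ξ)) :
    (∏ i, ξ i) * m ∈ squaresIdeal ξ := by
  rw [span_range_fin_three ξ 0] at hm
  obtain ⟨a, b, c, rfl⟩ := Submodule.mem_span_triple.mp hm
  rw [prod_eq_mul_mul ξ 0]
  exact mem_squaresIdeal_of_eq 0 (ξ 1 * ξ 2 * a) (ξ 0 * ξ 2 * b) (ξ 0 * ξ 1 * c)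
    (by simp only [smul_eq_mul, zero_add]; ring)

lemma mul_mul_mem_squaresColonIdeal (i : Fin 3) {m : R} (hm : m ∈ Ideal.span (Set.range ξ)) :
    ξ i * ξ (i + 1) * m ∈ squaresColonIdeal ξ := by
  rw [span_range_fin_three ξ i] at hm
  obtain ⟨a, b, c, rfl⟩ := Submodule.mem_span_triple.mp hm
  refine (mem_squaresColonIdeal i).mpr ⟨c, mem_squaresIdeal_of_eq i (ξ (i + 1) * a) (ξ i * b) 0 ?_⟩
  simp only [smul_eq_mul]
  ring

/-- A parametrization of `productKernel (squaresIdeal ξ) ξ` modulo `squaresIdeal ξ`: the `i`-th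
entry of the image of `t` is `ξ i * (ξ (i + 2) * t (i + 2) - ξ (i + 1) * t (i + 1))`. -/
def kernelParam (ξ : Fin 3 → R) : (Fin 3 → R) →ₗ[R] (Fin 3 → R) :=
  LinearMap.mulLeft R ξ ∘ₗ crossProduct (1 : Fin 3 → R) ∘ₗ LinearMap.mulLeft R ξ

lemma kernelParam_apply (ξ t : Fin 3 → R) (i : Fin 3) :
    kernelParam ξ t i = ξ i * (ξ (i + 2) * t (i + 2) - ξ (i + 1) * t (i + 1)) := by
  fin_cases i <;> simp [kernelParam, cross_apply]

lemma mem_productKernel_fin_three {J : Ideal R} {h : Fin 3 → R} (h₀ : ∀ i, ξ i * h i ∈ J)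
    (h₁ : ∀ i, ξ i * h (i + 1) + ξ (i + 1) * h i ∈ J) : h ∈ productKernel J ξ := by
  intro i j
  obtain rfl | rfl | rfl : j = i ∨ j = i + 1 ∨ i = j + 1 := by decide +revert
  · exact add_mem (h₀ _) (h₀ _)
  · exact h₁ _
  · rw [add_comm]
    exact h₁ _

lemma kernelParam_mem (t : Fin 3 → R) : kernelParam ξ t ∈ productKernel (squaresIdeal ξ) ξ := by
  refine mem_productKernel_fin_three (fun i => ?_) fun i => ?_
  · rw [kernelParam_apply]
    exact mem_squaresIdeal_of_eq i (ξ (i + 2) * t (i + 2) - ξ (i + 1) * t (i + 1)) 0 0 (by ring)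
  · rw [kernelParam_apply, kernelParam_apply]
    refine mem_squaresIdeal_of_eq i (ξ (i + 1) * t i) (-(ξ i * t (i + 1))) 0 ?_
    rw [add_assoc, add_assoc, show (1 : Fin 3) + 2 = 0 from rfl, show (1 : Fin 3) + 1 = 2 from rfl,
      add_zero]
    ring

lemma squaresColonIdeal_smul_top_le : squaresColonIdeal ξ • (⊤ : Submodule R (Fin 3 → R)) ≤
    productKernel (squaresIdeal ξ) ξ := fun _ hh i j =>
  add_mem (mul_mem_squaresIdeal i (mem_smul_top_pi_iff.mp hh j))
    (mul_mem_squaresIdeal j (mem_smul_top_pi_iff.mp hh i))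

namespace PowersKoszulAcyclic

variable (H : PowersKoszulAcyclic (ξ 0) (ξ 1) (ξ 2))

include H

lemma exists_sub_mul_mem (i : Fin 3) {m : R} (hm : ξ i * m ∈ squaresIdeal ξ) :
    ∃ n, m - ξ i * n ∈ squaresIdeal ξ := by
  rw [squaresIdeal_eq ξ i] at hm
  obtain ⟨a, b, c, rfl⟩ := Submodule.mem_span_triple.mp <|
    (H.shift i).mem_span_of_monomial_mul_mem one_pos two_pos two_pos 1 0 0 (by simpa using hm)
  exact ⟨a, mem_squaresIdeal_of_eq i 0 b c (by simp only [smul_eq_mul]; ring)⟩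

lemma exists_eq_of_mul_mul_mem (i : Fin 3) {m : R} (hm : ξ i * ξ (i + 1) * m ∈ squaresIdeal ξ) :
    ∃ a b c, m = a * ξ i + b * ξ (i + 1) + c * ξ (i + 2) ^ 2 := by
  rw [squaresIdeal_eq ξ i] at hm
  obtain ⟨a, b, c, rfl⟩ := Submodule.mem_span_triple.mp <|
    (H.shift i).mem_span_of_monomial_mul_mem one_pos one_pos two_pos 1 1 0 (by simpa using hm)
  exact ⟨a, b, c, by simp⟩

lemma mem_span_range_of_prod_mul_mem {m : R} (hm : (∏ i, ξ i) * m ∈ squaresIdeal ξ) :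
    m ∈ Ideal.span (Set.range ξ) := by
  rw [squaresIdeal_eq ξ 0, prod_eq_mul_mul ξ 0] at hm
  rw [span_range_fin_three ξ 0]
  simpa using H.mem_span_of_monomial_mul_mem one_pos one_pos one_pos 1 1 1 (by simpa using hm)

lemma kernelParam_mem_smul_top_iff (t : Fin 3 → R) :
    kernelParam ξ t ∈ squaresColonIdeal ξ • (⊤ : Submodule R (Fin 3 → R)) ↔
      ∀ i, t i ∈ Ideal.span (Set.range ξ) := by
  rw [mem_smul_top_pi_iff]
  constructor
  · intro h
    suffices ∀ i, t (i + 2) ∈ Ideal.span (Set.range ξ) from fun i => by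
      simpa [add_assoc] using this (i + 1)
    intro i
    obtain ⟨n, hn⟩ := (mem_squaresColonIdeal i).mp (h i)
    rw [kernelParam_apply, squaresIdeal_eq ξ i] at hn
    obtain ⟨a, b, c, habc⟩ := Submodule.mem_span_triple.mp <|
      (H.shift i).mem_span_of_monomial_mul_mem one_pos two_pos two_pos 1 0 0
        (m := ξ (i + 2) * t (i + 2) - ξ (i + 1) * t (i + 1) - ξ (i + 1) * ξ (i + 2) * n)
        (by convert hn using 1; ring)
    have := (H.shift i).mem_span_of_monomial_mul_mem (m := t (i + 2)) one_pos one_pos one_pos 0 0 1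
      (Submodule.mem_span_triple.mpr
        ⟨a, b * ξ (i + 1) + t (i + 1) + ξ (i + 2) * n, c, by
          simp only [smul_eq_mul] at habc ⊢
          linear_combination habc⟩)
    simpa [span_range_fin_three ξ i] using this
  · intro h i
    rw [kernelParam_apply, mul_sub, ← mul_assoc, ← mul_assoc]
    refine sub_mem ?_ (mul_mul_mem_squaresColonIdeal i (h (i + 1)))
    have := mul_mul_mem_squaresColonIdeal (i + 2) (h (i + 2))
    rwa [add_assoc, show (2 : Fin 3) + 1 = 0 from rfl, add_zero, mul_comm (ξ (i + 2))] at this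

lemma exists_sub_kernelParam_mem (h2 : IsUnit (2 : R)) {h : Fin 3 → R}
    (hh : h ∈ productKernel (squaresIdeal ξ) ξ) :
    ∃ t, ∀ i, h i - kernelParam ξ t i ∈ squaresIdeal ξ := by
  have two {m : R} : 2 * m ∈ squaresIdeal ξ → m ∈ squaresIdeal ξ :=
    (Ideal.unit_mul_mem_iff_mem _ h2).mp
  choose g hg using fun i => H.exists_sub_mul_mem i (two (two_mul (ξ i * h i) ▸ hh i i))
  choose a b c habc using fun i => H.exists_eq_of_mul_mul_mem i (m := g i + g (i + 1)) (by
    convert sub_mem (hh i (i + 1)) (add_mem (Ideal.mul_mem_left _ (ξ i) (hg (i + 1)))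
      (Ideal.mul_mem_left _ (ξ (i + 1)) (hg i))) using 1
    ring)
  obtain ⟨half, hhalf⟩ := h2.exists_right_inv
  refine ⟨fun k => half * (a k - b (k + 2)), fun i => ?_⟩
  rw [← sub_add_sub_cancel _ (ξ i * g i)]
  refine add_mem (hg i) (mem_squaresIdeal_of_eq i (half * (a i + b (i + 2) - c (i + 1) * ξ i))
    (half * (c (i + 2) * ξ i)) (half * (c i * ξ i)) ?_)
  have e₀ := habc i
  have e₁ := habc (i + 1)
  have e₂ := habc (i + 2)
  rw [kernelParam_apply]
  simp only [add_assoc, show (1 : Fin 3) + 1 = 2 from rfl, show (1 : Fin 3) + 2 = 0 from rfl,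
    show (2 : Fin 3) + 1 = 0 from rfl, show (2 : Fin 3) + 2 = 1 from rfl, add_zero] at e₀ e₁ e₂ ⊢
  linear_combination half * ξ i * (e₀ + e₂ - e₁) + (-ξ i * g i) * hhalf

lemma length_squaresColonIdeal_smul_top_quotient :
    Module.length R (↥(squaresColonIdeal ξ • (⊤ : Submodule R (Fin 3 → R))) ⧸
      (squaresIdeal ξ • (⊤ : Submodule R (Fin 3 → R))).submoduleOf (squaresColonIdeal ξ • ⊤)) =
      3 * Module.length R (R ⧸ Ideal.span (Set.range ξ)) := by
  refine length_quotient_submoduleOf_of_linearMap (Ideal.span (Set.range ξ))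
    (LinearMap.lsmul R (Fin 3 → R) (∏ i, ξ i)) (fun s => ?_) (fun k hk => ?_) fun s => ?_
  · refine mem_smul_top_pi_iff.mpr fun i => ?_
    exact Ideal.mem_sup_right (Ideal.mul_mem_right _ _ (Ideal.mem_span_singleton_self _))
  · choose s hs using fun i => mem_sup_span_singleton_iff.mp (mem_smul_top_pi_iff.mp hk i)
    exact ⟨s, mem_smul_top_pi_iff.mpr hs⟩
  · refine mem_smul_top_pi_iff.trans
      (forall_congr' fun i => ⟨H.mem_span_range_of_prod_mul_mem, fun hs => ?_⟩)
    exact prod_mul_mem_squaresIdeal hs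

lemma length_productKernel_quotient (h2 : IsUnit (2 : R)) :
    Module.length R (productKernel (squaresIdeal ξ) ξ ⧸
      (squaresIdeal ξ • (⊤ : Submodule R (Fin 3 → R))).submoduleOf
        (productKernel (squaresIdeal ξ) ξ)) =
      6 * Module.length R (R ⧸ Ideal.span (Set.range ξ)) := by
  have le : squaresIdeal ξ ≤ squaresColonIdeal ξ := le_sup_left
  rw [length_quotient_submoduleOf_add (Submodule.smul_mono_left le) squaresColonIdeal_smul_top_le,
    H.length_squaresColonIdeal_smul_top_quotient,
    length_quotient_submoduleOf_of_linearMap _ (kernelParam ξ) kernelParam_mem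
      (fun k hk => ?_) H.kernelParam_mem_smul_top_iff, Fintype.card_fin, Nat.cast_ofNat, ← add_mul]
  · norm_num
  · obtain ⟨t, ht⟩ := H.exists_sub_kernelParam_mem h2 hk
    exact ⟨t, mem_smul_top_pi_iff.mpr fun i => le (ht i)⟩

end PowersKoszulAcyclic

end ProductKernelSquares

section SymbolicPower

variable {R : Type*} [CommRing R] {I : Ideal R} {n : ℕ} {r : R}

lemma mem_symbolicPower_iff :
    r ∈ symbolicPower I n ↔ ∀ P ∈ I.minimalPrimes, ∃ s ∉ P, s * r ∈ I ^ n := by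
  simp only [symbolicPower, Ideal.mem_iInf, Ideal.mem_comap, Subtype.forall]
  refine forall₂_congr fun P hP => ?_
  have : P.IsPrime := hP.1.1
  rw [IsLocalization.algebraMap_mem_map_algebraMap_iff P.primeCompl]
  simp only [Ideal.mem_primeCompl_iff]

lemma isSMulRegular_quotient_symbolicPower {t : R} (ht : ∀ P ∈ I.minimalPrimes, t ∉ P) :
    IsSMulRegular (R ⧸ symbolicPower I n) t := by
  rw [isSMulRegular_quotient_iff_mem_of_smul_mem]
  intro r hr
  rw [mem_symbolicPower_iff] at hr ⊢
  intro P hP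
  obtain ⟨s, hs, hsr⟩ := hr P hP
  refine ⟨s * t, fun h => (hP.1.1.mem_or_mem h).elim hs (ht P hP), ?_⟩
  rwa [mul_assoc]

lemma pow_le_symbolicPower : I ^ n ≤ symbolicPower I n := fun r hr =>
  mem_symbolicPower_iff.mpr fun P hP => ⟨1, P.ne_top_iff_one.mp hP.1.1.ne_top, by rwa [one_mul]⟩

lemma symbolicPower_ne_top (hI : I ≠ ⊤) (hn : n ≠ 0) : symbolicPower I n ≠ ⊤ := by
  obtain ⟨M, hM, hIM⟩ := Ideal.exists_le_maximal I hI
  obtain ⟨P, hP, -⟩ := Ideal.exists_minimalPrimes_le hIM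
  intro h
  obtain ⟨s, hs, hsI⟩ := mem_symbolicPower_iff.mp ((Ideal.eq_top_iff_one _).mp h) P hP
  exact hs (hP.1.2 (Ideal.pow_le_self hn (by rwa [mul_one] at hsI)))

variable [IsLocalRing R]

lemma localDepth_quotient_pos {t : R} (ht : t ∈ maximalIdeal R) (hI : I ≠ ⊤)
    (h : IsSMulRegular (R ⧸ I) t) : 0 < localDepth R (R ⧸ I) := by
  have : Nontrivial (R ⧸ I) := Ideal.Quotient.nontrivial_iff.mpr hI
  have reg : RingTheory.Sequence.IsRegular (R ⧸ I) [t] :=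
    .of_isWeaklyRegular_of_mem_maximalIdeal _ (by simpa)
      ((RingTheory.Sequence.isWeaklyRegular_singleton_iff _ _).mpr h)
  exact zero_lt_one.trans_le <| le_iSup (fun rs : {rs : List R //
    RingTheory.Sequence.IsRegular (R ⧸ I) rs ∧ ∀ r ∈ rs, r ∈ maximalIdeal R} =>
      (rs.1.length : ℕ∞)) ⟨[t], reg, by simpa⟩

lemma eq_maximalIdeal_of_mem {t : R} (hI : (I ⊔ Ideal.span {t}).radical = maximalIdeal R)
    {P : Ideal R} (hP : P.IsPrime) (hIP : I ≤ P) (ht : t ∈ P) : P = maximalIdeal R := by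
  refine le_antisymm (le_maximalIdeal hP.ne_top) ?_
  rw [← hI, hP.radical_le_iff]
  exact sup_le hIP ((Ideal.span_singleton_le_iff_mem _).mpr ht)

lemma mem_minimalPrimes_of_ne_maximalIdeal [Ring.KrullDimLE 1 (R ⧸ I)] {P : Ideal R}
    (hP : P.IsPrime) (hIP : I ≤ P) (hne : P ≠ maximalIdeal R) : P ∈ I.minimalPrimes := by
  have comap_map := Ideal.comap_map_mk hIP
  have hP' : (P.map (Ideal.Quotient.mk I)).IsPrime :=
    Ideal.map_isPrime_of_surjective Ideal.Quotient.mk_surjective (by rwa [Ideal.mk_ker])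
  rw [Ideal.minimalPrimes_eq_comap]
  refine ⟨_, (Ring.krullDimLE_one_iff.mp ‹_› _ hP').resolve_right fun hmax => hne ?_, comap_map⟩
  have := Ideal.comap_isMaximal_of_surjective _ (Ideal.Quotient.mk_surjective (I := I)) (H := hmax)
  exact eq_maximalIdeal (comap_map ▸ this)

lemma exists_pow_mul_mem_of_mem_symbolicPower [Ring.KrullDimLE 1 (R ⧸ I)] {t : R}
    (ht : t ∈ maximalIdeal R) (hr : r ∈ symbolicPower I n) : ∃ k, t ^ k * r ∈ I ^ n := by
  suffices t ∈ ((I ^ n).colon {r}).radical by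
    simpa [Ideal.mem_radical_iff, Submodule.mem_colon_singleton] using this
  rw [Ideal.radical_eq_sInf, Ideal.mem_sInf]
  rintro P ⟨hPr, hP⟩
  have hIP : I ≤ P := hP.le_of_pow_le (n := n) fun a ha =>
    hPr (Submodule.mem_colon_singleton.mpr (Ideal.mul_mem_right _ _ ha))
  by_cases hne : P = maximalIdeal R
  · exact hne ▸ ht
  · obtain ⟨s, hs, hsr⟩ :=
      mem_symbolicPower_iff.mp hr P (mem_minimalPrimes_of_ne_maximalIdeal hP hIP hne)
    exact absurd (hPr (Submodule.mem_colon_singleton.mpr hsr)) hs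

lemma krullDimLE_one_quotient [IsNoetherianRing R] {t : R}
    (hI : (I ⊔ Ideal.span {t}).radical = maximalIdeal R) : Ring.KrullDimLE 1 (R ⧸ I) := by
  have hIm : I ≤ maximalIdeal R := hI ▸ le_sup_left.trans Ideal.le_radical
  have : Nontrivial (R ⧸ I) :=
    Ideal.Quotient.nontrivial_iff.mpr (ne_top_of_le_ne_top Ideal.IsPrime.ne_top' hIm)
  have : IsLocalRing (R ⧸ I) := .of_surjective' _ Ideal.Quotient.mk_surjective
  have eq_of_mem {P : Ideal (R ⧸ I)} (hP : P.IsPrime) (ht : Ideal.Quotient.mk I t ∈ P) :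
      P.comap (Ideal.Quotient.mk I) = maximalIdeal R :=
    eq_maximalIdeal_of_mem hI (hP.comap _) (fun a ha => by
      simp [Ideal.mem_comap, Ideal.Quotient.eq_zero_iff_mem.mpr ha]) ht
  have hcomap := eq_maximalIdeal <| Ideal.comap_isMaximal_of_surjective _
    (Ideal.Quotient.mk_surjective (I := I)) (K := maximalIdeal (R ⧸ I))
  have ht : t ∈ (maximalIdeal (R ⧸ I)).comap (Ideal.Quotient.mk I) :=
    hcomap ▸ hI ▸ Ideal.le_radical (Ideal.mem_sup_right (Ideal.mem_span_singleton_self t))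
  have hmin : maximalIdeal (R ⧸ I) ∈ (Ideal.span {Ideal.Quotient.mk I t}).minimalPrimes := by
    refine ⟨⟨inferInstance, (Ideal.span_singleton_le_iff_mem _).mpr ht⟩, fun P ⟨hP, htP⟩ _ => ?_⟩
    exact (Ideal.comap_injective_of_surjective _ Ideal.Quotient.mk_surjective
      ((eq_of_mem hP ((Ideal.span_singleton_le_iff_mem _).mp htP)).trans hcomap.symm)).ge
  rw [Ring.krullDimLE_iff, ← maximalIdeal_height_eq_ringKrullDim]
  exact_mod_cast Ideal.height_le_one_of_isPrincipal_of_mem_minimalPrimes _ _ hmin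

end SymbolicPower

section ParameterMatrix

open Matrix

lemma radical_span_range_pow {R ι : Type*} [CommRing R] (ξ : ι → R) {n : ι → ℕ}
    (hn : ∀ i, 0 < n i) :
    (Ideal.span (Set.range fun i => ξ i ^ n i)).radical =
      (Ideal.span (Set.range ξ)).radical := by
  refine le_antisymm (Ideal.radical_mono (Ideal.span_le.mpr ?_))
    (Ideal.radical_le_radical_iff.mpr (Ideal.span_le.mpr ?_))
  · rintro _ ⟨i, rfl⟩
    exact Ideal.pow_mem_of_mem _ (Ideal.subset_span (Set.mem_range_self i)) _ (hn i)
  · rintro _ ⟨i, rfl⟩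
    exact ⟨n i, Ideal.subset_span ⟨i, rfl⟩⟩

variable {R : Type*} [CommRing R]

lemma powersKoszulAcyclic_of_radical_eq_maximalIdeal [IsLocalRing R]
    (hCM : IsCohenMacaulayLocal R) (hdim : ringKrullDim R = 3) {ξ : Fin 3 → R}
    (hξ : (Ideal.span (Set.range ξ)).radical = maximalIdeal R) :
    PowersKoszulAcyclic (ξ 0) (ξ 1) (ξ 2) := by
  intro a b c ha hb hc
  refine koszulAcyclic_of_radical_eq_maximalIdeal hCM hdim ?_
  have hpos : ∀ i, 0 < ![a, b, c] i := by simp [Fin.forall_fin_succ, ha, hb, hc]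
  rw [← hξ, ← radical_span_range_pow ξ hpos, span_range_fin_three _ 0]
  rfl

section ProductKernelAnnihilator

variable {ι : Type*} {J : Ideal R} {ξ h : ι → R}

lemma mul_mul_mem_of_mem_productKernel (h2 : IsUnit (2 : R)) (hh : h ∈ productKernel J ξ)
    (i j k : ι) : ξ i * ξ j * h k ∈ J := by
  rw [← Ideal.unit_mul_mem_iff_mem J h2]
  convert sub_mem (add_mem (J.mul_mem_left (ξ i) (hh j k)) (J.mul_mem_left (ξ j) (hh i k)))
    (J.mul_mem_left (ξ k) (hh i j)) using 1
  ring

lemma smul_mem_of_mem_productKernel [Finite ι] (h2 : IsUnit (2 : R))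
    (hh : h ∈ productKernel J ξ) {q : R} (hq : q ∈ Ideal.span (Set.range ξ) ^ 2) :
    q • h ∈ J • (⊤ : Submodule R (ι → R)) := by
  suffices Ideal.span (Set.range ξ) ^ 2 ≤ (J • (⊤ : Submodule R (ι → R))).colon {h} from
    Submodule.mem_colon_singleton.mp (this hq)
  rw [pow_two, Ideal.span_mul_span', Ideal.span_le]
  rintro _ ⟨_, ⟨i, rfl⟩, _, ⟨j, rfl⟩, rfl⟩
  refine Submodule.mem_colon_singleton.mpr ?_
  exact mem_smul_top_pi_iff.mpr (mul_mul_mem_of_mem_productKernel h2 hh i j)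

end ProductKernelAnnihilator

lemma mem_annihilator_quotient_submoduleOf {M : Type*} [AddCommGroup M] [Module R M]
    {L K : Submodule R M} {q : R} :
    q ∈ Module.annihilator R (K ⧸ L.submoduleOf K) ↔ ∀ k ∈ K, q • k ∈ L := by
  rw [Module.mem_annihilator, (Submodule.mkQ_surjective _).forall, Subtype.forall]
  refine forall₂_congr fun k hk => ?_
  rw [← map_smul, Submodule.mkQ_apply, Submodule.Quotient.mk_eq_zero]
  rfl

lemma cross_apply_eq (a b : Fin 3 → R) (i : Fin 3) :
    (a ⨯₃ b) i = a (i + 1) * b (i + 2) - a (i + 2) * b (i + 1) := by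
  fin_cases i <;> simp [cross_apply]

variable [IsLocalRing R] {a b : Fin 3 → R}

lemma IsRegularMatrix.colon_le_colon_sq [IsNoetherianRing R] (h : IsRegularMatrix a b)
    (h2 : IsUnit (2 : R)) {u v w : R} (hK : KoszulAcyclic u v w R) {J : Ideal R}
    (hJ : J = Ideal.span {u, v, w}) :
    (minorsIdeal a b ^ 3).colon (J : Set R) ≤
      (minorsIdeal a b ^ 3).colon ((Ideal.span (Set.range a) ^ 2 : Ideal R) : Set R) := by
  obtain ⟨e⟩ := h.nonempty_colon_cube_quotient_linearEquiv h2 hK hJ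
  intro r hr
  rw [Submodule.mem_colon]
  intro q hq
  have hq' := mem_annihilator_quotient_submoduleOf.mpr
    fun k (hk : k ∈ productKernel J a ⊓ productKernel J b) =>
      smul_mem_of_mem_productKernel h2 hk.1 hq
  rw [← e.annihilator_eq, mem_annihilator_quotient_submoduleOf] at hq'
  rw [smul_eq_mul, mul_comm]
  exact hq' r hr

/-- A `2 × 3` matrix over a local ring with rows `a` and `b` such that `a` is a system of
parameters, the entries of `b` are combinations of the squares of the entries of `a`, and the
pairs consisting of the minor `Δ = a 0 * b 1 - a 1 * b 0` with the entry `a 0`, respectively with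
the minor `a 2 * b 0 - a 0 * b 2`, are completed to systems of parameters by `a 2`. -/
structure IsParameterMatrix (a b : Fin 3 → R) : Prop where
  radical_row : (Ideal.span (Set.range a)).radical = maximalIdeal R
  mem_squaresIdeal : ∀ i, b i ∈ squaresIdeal a
  radical_entry : (Ideal.span {(a ⨯₃ b) 2, a 0, a 2}).radical = maximalIdeal R
  radical_minor : (Ideal.span {(a ⨯₃ b) 2, (a ⨯₃ b) 1, a 2}).radical = maximalIdeal R

namespace IsParameterMatrix

variable (h : IsParameterMatrix a b)

include h

lemma span_range_le_maximalIdeal : Ideal.span (Set.range a) ≤ maximalIdeal R :=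
  h.radical_row ▸ Ideal.le_radical

lemma mem_maximalIdeal (i : Fin 3) : a i ∈ maximalIdeal R :=
  h.span_range_le_maximalIdeal (Ideal.subset_span ⟨i, rfl⟩)

lemma minors_le_maximalIdeal_mul :
    minorsIdeal a b ≤ maximalIdeal R * Ideal.span (Set.range a) := by
  have hb : squaresIdeal a ≤ maximalIdeal R := Ideal.span_le.mpr (by
    rintro _ ⟨i, rfl⟩
    exact Ideal.pow_mem_of_mem _ (h.mem_maximalIdeal i) _ two_pos)
  refine Ideal.span_le.mpr ?_
  rintro _ ⟨i, rfl⟩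
  rw [cross_apply_eq, SetLike.mem_coe, mul_comm (a _), mul_comm (a _)]
  exact sub_mem
    (Ideal.mul_mem_mul (hb (h.mem_squaresIdeal _)) (Ideal.subset_span (Set.mem_range_self _)))
    (Ideal.mul_mem_mul (hb (h.mem_squaresIdeal _)) (Ideal.subset_span (Set.mem_range_self _)))

lemma minors_le_maximalIdeal : minorsIdeal a b ≤ maximalIdeal R :=
  h.minors_le_maximalIdeal_mul.trans Ideal.mul_le_left

lemma radical_minors_sup_span_singleton :
    (minorsIdeal a b ⊔ Ideal.span {a 2}).radical = maximalIdeal R := by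
  refine le_antisymm ?_ ?_
  · rw [(maximalIdeal.isMaximal R).isPrime.radical_le_iff]
    exact sup_le h.minors_le_maximalIdeal
      ((Ideal.span_singleton_le_iff_mem _).mpr (h.mem_maximalIdeal 2))
  · rw [← h.radical_minor]
    refine Ideal.radical_mono (Ideal.span_le.mpr ?_)
    rintro _ (rfl | rfl | rfl)
    exacts [Ideal.mem_sup_left (Ideal.subset_span (Set.mem_range_self 2)),
      Ideal.mem_sup_left (Ideal.subset_span (Set.mem_range_self 1)),
      Ideal.mem_sup_right (Ideal.mem_span_singleton_self _)]

variable (hCM : IsCohenMacaulayLocal R) (hdim : ringKrullDim R = 3)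

include hCM hdim

lemma isRegularMatrix : IsRegularMatrix a b :=
  ⟨h.mem_maximalIdeal, koszulAcyclic_of_radical_eq_maximalIdeal hCM hdim h.radical_entry,
    koszulAcyclic_of_radical_eq_maximalIdeal hCM hdim h.radical_minor⟩

lemma maximalIdeal_notMem_minimalPrimes_minors :
    maximalIdeal R ∉ (minorsIdeal a b).minimalPrimes := by
  intro hmin
  have hrad : (minorsIdeal a b).radical = maximalIdeal R := by
    refine le_antisymm (hmin.1.1.radical_le_iff.mpr hmin.1.2) ?_
    rw [Ideal.radical_eq_sInf]
    exact le_sInf fun P hP => hmin.2 ⟨hP.2, hP.1⟩ (le_maximalIdeal hP.2.ne_top)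
  have hspan := span_range_fin_three (a ⨯₃ b) 0
  have hle : Ideal.span (Set.range a) ≤ minorsIdeal a b := by
    rw [minorsIdeal, hspan] at hrad
    obtain ⟨n₁, n₂, n₃, e₁, e₂, e₃⟩ :=
      (koszulAcyclic_of_radical_eq_maximalIdeal hCM hdim hrad).one (a 0) (a 1) (a 2) (by
        simp only [cross_apply_eq, smul_eq_mul, Fin.reduceAdd]
        ring)
    have hmem (i : Fin 3) : (a ⨯₃ b) i ∈ minorsIdeal a b :=
      Ideal.subset_span (Set.mem_range_self i)
    refine Ideal.span_le.mpr ?_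
    rintro _ ⟨i, rfl⟩
    fin_cases i
    exacts [e₁ ▸ sub_mem (Ideal.mul_mem_right _ _ (hmem _)) (Ideal.mul_mem_right _ _ (hmem _)),
      e₂ ▸ sub_mem (Ideal.mul_mem_right _ _ (hmem _)) (Ideal.mul_mem_right _ _ (hmem _)),
      e₃ ▸ sub_mem (Ideal.mul_mem_right _ _ (hmem _)) (Ideal.mul_mem_right _ _ (hmem _))]
  have hbot : Ideal.span (Set.range a) = ⊥ :=
    Submodule.eq_bot_of_le_smul_of_le_jacobson_bot (maximalIdeal R) _
      (Submodule.fg_span (Set.finite_range a)) (hle.trans h.minors_le_maximalIdeal_mul)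
      (maximalIdeal_le_jacobson ⊥)
  have ha (i : Fin 3) : a i = 0 := by
    rw [← Ideal.mem_bot, ← hbot]
    exact Ideal.subset_span (Set.mem_range_self i)
  have hK := powersKoszulAcyclic_of_radical_eq_maximalIdeal hCM hdim h.radical_row
  exact one_ne_zero <| (hK one_pos one_pos one_pos).three 1
    (by simp [ha]) (by simp [ha]) (by simp [ha])

lemma notMem_of_mem_minimalPrimes_minors {P : Ideal R}
    (hP : P ∈ (minorsIdeal a b).minimalPrimes) : a 2 ∉ P := fun ha =>
  h.maximalIdeal_notMem_minimalPrimes_minors hCM hdim <|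
    eq_maximalIdeal_of_mem h.radical_minors_sup_span_singleton hP.1.1 hP.1.2 ha ▸ hP

lemma isSMulRegular_quotient_symbolicPower_minors (n : ℕ) :
    IsSMulRegular (R ⧸ symbolicPower (minorsIdeal a b) n) (a 2) :=
  isSMulRegular_quotient_symbolicPower fun _ => h.notMem_of_mem_minimalPrimes_minors hCM hdim

theorem localDepth_quotient_symbolicPower_pos {n : ℕ} (hn : n ≠ 0) :
    0 < localDepth R (R ⧸ symbolicPower (minorsIdeal a b) n) := by
  refine localDepth_quotient_pos (h.mem_maximalIdeal 2) (symbolicPower_ne_top ?_ hn)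
    (h.isSMulRegular_quotient_symbolicPower_minors hCM hdim n)
  exact ne_top_of_le_ne_top Ideal.IsPrime.ne_top' h.minors_le_maximalIdeal

theorem symbolicPower_three_minors (h2 : IsUnit (2 : R)) :
    symbolicPower (minorsIdeal a b) 3 =
      (minorsIdeal a b ^ 3).colon
        ((Ideal.span (Set.range a) ^ 2 : Ideal R) : Set R) := by
  have := hCM.1
  have := krullDimLE_one_quotient h.radical_minors_sup_span_singleton
  refine le_antisymm (fun r hr => ?_) fun r hr => ?_
  · choose k hk using fun i => exists_pow_mul_mem_of_mem_symbolicPower (h.mem_maximalIdeal i) hr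
    have hK : KoszulAcyclic (a 0 ^ (k 0 + 1)) (a 1 ^ (k 1 + 1)) (a 2 ^ (k 2 + 1)) R :=
      powersKoszulAcyclic_of_radical_eq_maximalIdeal hCM hdim h.radical_row
        (k 0).succ_pos (k 1).succ_pos (k 2).succ_pos
    refine (h.isRegularMatrix hCM hdim).colon_le_colon_sq h2 hK rfl ?_
    rw [Ideal.colon_span]
    refine Submodule.mem_colon.mpr ?_
    rintro _ (rfl | rfl | rfl) <;>
    · rw [smul_eq_mul, mul_comm, pow_succ' (a _), mul_assoc]
      exact Ideal.mul_mem_left _ _ (hk _)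
  · refine mem_of_isSMulRegular_quotient_of_smul_mem
      ((h.isSMulRegular_quotient_symbolicPower_minors hCM hdim 3).pow 2)
      (pow_le_symbolicPower ?_)
    rw [smul_eq_mul, mul_comm]
    exact Submodule.mem_colon.mp hr _
      (Ideal.pow_mem_pow (Ideal.subset_span (Set.mem_range_self 2)) 2)

theorem length_symbolicPower_three_minors (h2 : IsUnit (2 : R)) :
    Module.length R (symbolicPower (minorsIdeal a b) 3 ⧸
      (minorsIdeal a b ^ 3).submoduleOf
        (symbolicPower (minorsIdeal a b) 3)) =
      6 * Module.length R (R ⧸ Ideal.span (Set.range a)) := by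
  have := hCM.1
  have hM := h.isRegularMatrix hCM hdim
  have H := powersKoszulAcyclic_of_radical_eq_maximalIdeal hCM hdim h.radical_row
  have hK := H two_pos two_pos two_pos
  have hcolon : symbolicPower (minorsIdeal a b) 3 =
      (minorsIdeal a b ^ 3).colon (squaresIdeal a : Set R) := by
    rw [h.symbolicPower_three_minors hCM hdim h2]
    refine le_antisymm (Submodule.colon_mono le_rfl ?_)
      (hM.colon_le_colon_sq h2 hK (squaresIdeal_eq a 0))
    refine Ideal.span_le.mpr ?_
    rintro _ ⟨i, rfl⟩
    exact Ideal.pow_mem_pow (Ideal.subset_span (Set.mem_range_self i)) 2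
  have htop : productKernel (squaresIdeal a) b = ⊤ :=
    eq_top_iff.mpr fun k _ i j =>
      add_mem (Ideal.mul_mem_right _ _ (h.mem_squaresIdeal i))
        (Ideal.mul_mem_right _ _ (h.mem_squaresIdeal j))
  obtain ⟨e⟩ := hM.nonempty_colon_cube_quotient_linearEquiv h2 hK (squaresIdeal_eq a 0)
  rw [hcolon, e.length_eq, htop, inf_top_eq, H.length_productKernel_quotient h2]

end IsParameterMatrix

end ParameterMatrix

namespace StarTransform

variable {R : Type*} [CommRing R]

lemma phi13_eq_sum {x y z : R} {β γ β' γ' : ℕ} (hβ : β ≤ β') (hγ : γ ≤ γ') (M : Fin 3) :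
    phi13 x y z β γ β' γ' M =
      ∑ j : Fin 3, (![x, y ^ β, z ^ γ] j) • v1 x y z β γ β' γ' (j, M) := by
  simp only [phi13, v1, Fin.sum_univ_three, ← pow_mul_pow_sub y hβ, ← pow_mul_pow_sub z hγ,
    Matrix.cons_val_zero, Matrix.cons_val_one, Matrix.cons_val]
  module

lemma phi3_single (ξ : Fin 3 → R) {Λ F₂ : Type*} [Fintype Λ] [DecidableEq Λ] [AddCommGroup F₂]
    [Module R F₂] (v : Fin 3 × Λ → F₂) (i : Fin 3) (l : Λ) :
    phi3 ξ v (Pi.single (i, l) 1) =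
      (ξ (i.succAbove 0) • Pi.single (i.succAbove 1, l) 1 -
        ξ (i.succAbove 1) • Pi.single (i.succAbove 0, l) 1, (-1 : R) ^ (i.val + 1) • v (i, l)) := by
  rw [phi3, Fintype.linearCombination_apply_single, one_smul]
  simp only [← Pi.single_smul, smul_eq_mul, mul_one]

lemma phi3_w2 {x y z : R} {β γ β' γ' : ℕ} (hβ : 2 * β ≤ β') (hγ : 2 * γ ≤ γ') (l : Fin 3) :
    phi3 ![x, y ^ β, z ^ γ] (v1 x y z β γ β' γ') (w2 R l) =
      ((∑ j : Fin 3, (![x, y ^ β, z ^ γ] j) • v2 y z β γ β' γ' (j, l) : F22 R) :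
        (Fin 3 × Fin 3 → R) × (S2 R × S2 R)) := by
  have hy : y ^ (β' - β) = y ^ β * y ^ (β' - 2 * β) := by rw [← pow_add]; congr 1; omega
  have hz : z ^ (γ' - γ) = z ^ γ * z ^ (γ' - 2 * γ) := by rw [← pow_add]; congr 1; omega
  have hsucc : (0 : Fin 3).succAbove (0 : Fin 2) = 1 ∧ (0 : Fin 3).succAbove (1 : Fin 2) = 2 ∧
      (1 : Fin 3).succAbove (0 : Fin 2) = 0 ∧ (1 : Fin 3).succAbove (1 : Fin 2) = 2 ∧
      (2 : Fin 3).succAbove (0 : Fin 2) = 0 ∧ (2 : Fin 3).succAbove (1 : Fin 2) = 1 := by decide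
  have hswap : s((1 : Fin 3), 0) = s(0, 1) ∧ s((2 : Fin 3), 0) = s(0, 2) ∧
      s((2 : Fin 3), 1) = s(1, 2) := by decide
  fin_cases l <;>
  · simp only [w2, Fin.zero_eta, Fin.mk_one, Fin.reduceFinMk, map_add, map_sub, map_neg,
      phi3_single, hsucc, hswap, v1, v2, br, abr, hy, hz, Fin.sum_univ_three,
      Matrix.cons_val_zero, Matrix.cons_val_one, Matrix.cons_val, Submodule.coe_add,
      Submodule.coe_smul, Submodule.coe_neg, Submodule.coe_sub, Fin.val_zero, Fin.val_one,
      Fin.val_two, Prod.mk_add_mk, Prod.mk_sub_mk, Prod.neg_mk, Prod.smul_mk,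
      Prod.mk.injEq]
    exact ⟨by module, by module⟩

section Basis

variable (R)

/-- The elements `[i, M]` and `⟨[N]⟩` that generate `F²₂`, as one family. -/
def generators : (Fin 3 × Fin 3) ⊕ Sym2 (Fin 3) → F22 R :=
  Sum.elim (fun p => br R p.1 p.2) (abr R)

lemma linearIndependent_generators : LinearIndependent R (generators R) := by
  refine LinearIndependent.of_comp (F22 R).subtype ?_
  convert ((Pi.basisFun R (Fin 3 × Fin 3)).prod ((Pi.basisFun R (Sym2 (Fin 3))).prod
    (Pi.basisFun R (Sym2 (Fin 3))))).linearIndependent.comp _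
    (Sum.map_injective.mpr ⟨Function.injective_id, Sum.inl_injective⟩) using 1
  ext1 (p | N) <;> simp [generators, br, abr, sq]

lemma span_range_generators : Submodule.span R (Set.range (generators R)) = ⊤ := by
  refine Submodule.map_injective_of_injective (F22 R).injective_subtype ?_
  rw [Submodule.map_span, ← Set.range_comp, Submodule.map_subtype_top]
  refine congrArg (Submodule.span R) ?_
  rw [← Set.range_comp, ← Set.Sum.elim_range]
  congr 1
  ext1 (p | N) <;> rfl

lemma finrank_F22 [Nontrivial R] :
    Module.finrank R (F22 R) = Fintype.card ((Fin 3 × Fin 3) ⊕ Sym2 (Fin 3)) :=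
  Module.finrank_eq_card_basis
    (.mk (linearIndependent_generators R) (span_range_generators R).ge)

variable {R}

lemma br_mem_of_v2_mem (h2 : IsUnit (2 : R)) {y z : R} {β γ β' γ' : ℕ} {L : Submodule R (F22 R)}
    (hv : ∀ p, v2 y z β γ β' γ' p ∈ L) (hN : ∀ N, abr R N ∈ L) (i M : Fin 3) : br R i M ∈ L := by
  have hsmul (r : R) (N) := L.smul_mem r (hN N)
  have h11 : br R 1 1 ∈ L := by
    rw [← L.smul_mem_iff_of_isUnit h2]
    convert add_mem (add_mem (hv (2, 0)) (hv (1, 1))) (hv (0, 2)) using 1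
    simp only [v2]
    module
  have h00 : br R 0 0 ∈ L := (add_mem_cancel_left h11).mp (hv (2, 0))
  have h22 : br R 2 2 ∈ L := (add_mem_cancel_right h11).mp (hv (0, 2))
  have h01 : br R 0 1 ∈ L := neg_mem_iff.mp ((L.sub_mem_iff_left (hsmul _ _)).mp (hv (1, 2)))
  have h02 : br R 0 2 ∈ L := neg_mem_iff.mp ((add_mem_cancel_right (hsmul _ _)).mp (hv (2, 2)))
  have h10 : br R 1 0 ∈ L := (L.sub_mem_iff_left (hN _)).mp (hv (0, 1))
  have h12 : br R 1 2 ∈ L := (add_mem_cancel_right (hsmul _ _)).mp (hv (2, 1))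
  have h20 : br R 2 0 ∈ L := neg_mem_iff.mp ((L.sub_mem_iff_left (hN _)).mp (hv (0, 0)))
  have h21 : br R 2 1 ∈ L := neg_mem_iff.mp ((add_mem_cancel_right (hsmul _ _)).mp (hv (1, 0)))
  fin_cases i <;> fin_cases M <;> assumption

theorem admissible_v2 [Nontrivial R] (h2 : IsUnit (2 : R)) (y z : R) (β γ β' γ' : ℕ) :
    Admissible (R := R) (v2 y z β γ β' γ') Set.univ := by
  set family := Sum.elim (v2 y z β γ β' γ') (abr R)
  have hmem i : family i ∈ Submodule.span R (Set.range family) :=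
    Submodule.subset_span (Set.mem_range_self i)
  have hspan : ⊤ ≤ Submodule.span R (Set.range family) := by
    rw [← span_range_generators R, Submodule.span_le]
    rintro _ ⟨p | N, rfl⟩
    exacts [br_mem_of_v2_mem h2 (fun p => hmem (.inl p)) (fun N => hmem (.inr N)) p.1 p.2,
      hmem (.inr N)]
  have hinj : Function.Injective (abr R) :=
    (linearIndependent_generators R).injective.comp Sum.inr_injective
  refine ⟨Set.range (abr R), (basisOfTopLeSpanOfCardEqFinrank family hspan
    (finrank_F22 R).symm).reindex
    (Equiv.sumCongr (Equiv.Set.univ _).symm (Equiv.ofInjective _ hinj)), fun t => ?_, ?_⟩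
  · simp [family]
  · rintro ⟨_, N, rfl⟩
    simp [family]

end Basis

end StarTransform

section Parameters

open Matrix

variable {R : Type*} [CommRing R]

lemma maximalMinorsIdeal_eq_minorsIdeal (a b : Fin 3 → R) :
    maximalMinorsIdeal (Matrix.of ![a, b]) = minorsIdeal a b := by
  apply le_antisymm
  · refine Ideal.span_le.mpr ?_
    rintro _ ⟨e, rfl⟩
    have hmem (i : Fin 3) : (a ⨯₃ b) i ∈ minorsIdeal a b :=
      Ideal.subset_span (Set.mem_range_self i)
    have hlt : e 0 < e 1 := e.strictMono (by decide)
    simp only [det_fin_two, submatrix_apply, id_eq, SetLike.mem_coe]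
    generalize e 0 = i, e 1 = j at hlt
    fin_cases i <;> fin_cases j <;> try exact absurd hlt (by decide)
    · convert hmem 2 using 1; simp [cross_apply]
    · convert neg_mem (hmem 1) using 1; simp [cross_apply]
    · convert hmem 0 using 1; simp [cross_apply]
  · have hmem (v : Fin 2 → Fin 3) (hv : StrictMono v) :
        ((Matrix.of ![a, b]).submatrix id v).det ∈ maximalMinorsIdeal (Matrix.of ![a, b]) :=
      Ideal.subset_span ⟨OrderEmbedding.ofStrictMono v hv, rfl⟩
    refine Ideal.span_le.mpr ?_
    rintro _ ⟨i, rfl⟩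
    fin_cases i
    · simpa [det_fin_two, cross_apply] using hmem ![1, 2] (by decide)
    · simpa [det_fin_two, cross_apply] using neg_mem (hmem ![0, 2] (by decide))
    · simpa [det_fin_two, cross_apply] using hmem ![0, 1] (by decide)

lemma radical_eq_maximalIdeal_of_forall_mem_radical [IsLocalRing R] {ι : Type*} {ξ : ι → R}
    (hξ : (Ideal.span (Set.range ξ)).radical = maximalIdeal R) {J : Ideal R}
    (hJ : J ≤ maximalIdeal R) (h : ∀ i, ξ i ∈ J.radical) : J.radical = maximalIdeal R := by
  refine le_antisymm ((maximalIdeal.isMaximal R).isPrime.radical_le_iff.mpr hJ) ?_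
  rw [← hξ, Ideal.radical_le_radical_iff, Ideal.span_le]
  rintro _ ⟨i, rfl⟩
  exact h i

lemma isParameterMatrix_of_sq_dvd [IsLocalRing R] {x v w p q : R} {n : ℕ}
    (hm : (Ideal.span (Set.range ![x, v, w])).radical = maximalIdeal R)
    (hvp : v ^ 2 ∣ p) (hwq : w ^ 2 ∣ q) (hpv : p ∣ v ^ n) :
    IsParameterMatrix ![x, v, w] ![p, q, x ^ 2] := by
  have hmem (i : Fin 3) : ![x, v, w] i ∈ maximalIdeal R :=
    hm ▸ Ideal.le_radical (Ideal.subset_span ⟨i, rfl⟩)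
  have hΔ₁ : (![x, v, w] ⨯₃ ![p, q, x ^ 2]) 1 = w * p - x ^ 3 := by
    simp [cross_apply, ← pow_succ']
  have hΔ₂ : (![x, v, w] ⨯₃ ![p, q, x ^ 2]) 2 = x * q - v * p := by
    simp [cross_apply]
  have hrad {t : R} (ht : t ∈ maximalIdeal R)
      (hx : x ∈ (Ideal.span {x * q - v * p, t, w}).radical) :
      (Ideal.span {x * q - v * p, t, w}).radical = maximalIdeal R := by
    set J := Ideal.span {x * q - v * p, t, w}
    have hw : w ∈ J := Ideal.subset_span (by simp)
    have hvpJ : v * p ∈ J :=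
      (J.sub_mem_iff_right (J.mem_of_dvd (dvd_mul_of_dvd_right ((dvd_pow_self w two_ne_zero).trans
        hwq) x) hw)).mp (Ideal.subset_span (by simp))
    have hv : v ^ (n + 1) ∈ J := J.mem_of_dvd (pow_succ' v n ▸ mul_dvd_mul_left v hpv) hvpJ
    refine radical_eq_maximalIdeal_of_forall_mem_radical hm (Ideal.span_le.mpr ?_) ?_
    · rintro _ (rfl | rfl | rfl)
      exacts [sub_mem (Ideal.mul_mem_right _ _ (hmem 0)) (Ideal.mul_mem_right _ _ (hmem 1)), ht,
        hmem 2]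
    · simpa [Fin.forall_fin_succ] using ⟨hx, ⟨n + 1, hv⟩, Ideal.le_radical hw⟩
  refine ⟨hm, ?_, ?_, ?_⟩
  · have hsq (i : Fin 3) {t : R} (h : ![x, v, w] i ^ 2 ∣ t) : t ∈ squaresIdeal ![x, v, w] :=
      Ideal.mem_of_dvd _ h (Ideal.subset_span ⟨i, rfl⟩)
    simpa [Fin.forall_fin_succ] using ⟨hsq 1 hvp, hsq 2 hwq, hsq 0 dvd_rfl⟩
  · rw [hΔ₂]
    exact hrad (hmem 0) (Ideal.le_radical (Ideal.subset_span (by simp)))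
  · rw [hΔ₁, hΔ₂]
    refine hrad (sub_mem (Ideal.mul_mem_right _ _ (hmem 2))
      (Ideal.pow_mem_of_mem _ (hmem 0) _ three_pos)) ⟨3, ?_⟩
    exact (Submodule.sub_mem_iff_right _ (Ideal.mul_mem_right p _ (Ideal.subset_span
      (by simp)))).mp (Ideal.subset_span (Set.mem_insert_of_mem _ (Set.mem_insert _ _)))

lemma isParameterMatrix_pow [IsLocalRing R] {x y z : R}
    (hxyz : (Ideal.span (Set.range ![x, y, z])).radical = maximalIdeal R)
    {β γ β' γ' : ℕ} (hβ : 0 < β) (hγ : 0 < γ) (hββ' : 2 * β ≤ β') (hγγ' : 2 * γ ≤ γ') :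
    IsParameterMatrix ![x, y ^ β, z ^ γ] ![y ^ β', z ^ γ', x ^ 2] := by
  refine isParameterMatrix_of_sq_dvd (n := β') ?_ ?_ ?_ ?_
  · have hpos : ∀ i, 0 < ![1, β, γ] i := by simp [Fin.forall_fin_succ, hβ, hγ]
    rw [← hxyz, ← radical_span_range_pow ![x, y, z] hpos]
    congr 4
    ext i
    fin_cases i <;> simp
  · rw [← pow_mul']
    exact pow_dvd_pow y hββ'
  · rw [← pow_mul']
    exact pow_dvd_pow z hγγ'
  · rw [← pow_mul]
    exact pow_dvd_pow y (Nat.le_mul_of_pos_left _ hβ)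

end Parameters

theorem theorem4p10 {R : Type*} [CommRing R] [IsLocalRing R]
    (hCM : IsCohenMacaulayLocal R) (hdim : ringKrullDim R = 3)
    (x y z : R) (hsop : IsSystemOfParameters ![x, y, z])
    (α β γ α' β' γ' : ℕ) (hβ : 0 < β) (hγ : 0 < γ) (hβ' : 0 < β') (hγ' : 0 < γ')
    (hα : α = 1) (hα' : α' = 2) (hββ' : 2 * β ≤ β') (hγγ' : 2 * γ ≤ γ')
    (h2 : IsUnit (2 : R))
    (I Q : Ideal R)
    (hI : I = maximalMinorsIdeal !![x ^ α, y ^ β, z ^ γ; y ^ β', z ^ γ', x ^ α'])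
    (hQ : Q = Ideal.span {x ^ min α α', y ^ min β β', z ^ min γ γ'}) :
    ((∀ M : Fin 3, StarTransform.phi13 x y z β γ β' γ' M =
        ∑ j : Fin 3, (![x, y ^ β, z ^ γ] j) • StarTransform.v1 x y z β γ β' γ' (j, M)) ∧
      (∀ l : Fin 3,
        StarTransform.phi3 ![x, y ^ β, z ^ γ] (StarTransform.v1 x y z β γ β' γ')
            (StarTransform.w2 R l) =
          ((∑ j : Fin 3, (![x, y ^ β, z ^ γ] j) • StarTransform.v2 y z β γ β' γ' (j, l) :
            StarTransform.F22 R) :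
            (Fin 3 × Fin 3 → R) × (StarTransform.S2 R × StarTransform.S2 R))) ∧
      StarTransform.Admissible (R := R) (StarTransform.v2 y z β γ β' γ') Set.univ) ∧
    0 < localDepth R (R ⧸ (I ^ 3).colon ((Q ^ 2 : Ideal R) : Set R)) ∧
    symbolicPower I 3 = (I ^ 3).colon ((Q ^ 2 : Ideal R) : Set R) ∧
    Module.length R (symbolicPower I 3 ⧸ (I ^ 3).submoduleOf (symbolicPower I 3)) =
      6 * Module.length R (R ⧸ Q) := by
  subst hα hα'
  have := hCM.1
  have hI' : I = minorsIdeal ![x, y ^ β, z ^ γ] ![y ^ β', z ^ γ', x ^ 2] := by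
    rw [hI, ← maximalMinorsIdeal_eq_minorsIdeal, pow_one]
  have hQ' : Q = Ideal.span (Set.range ![x, y ^ β, z ^ γ]) := by
    rw [hQ, min_eq_left one_le_two, min_eq_left (by omega), min_eq_left (by omega), pow_one,
      span_range_fin_three _ 0]
    rfl
  have hP := isParameterMatrix_pow hsop.2 hβ hγ hββ' hγγ'
  have hsymbolic := hP.symbolicPower_three_minors hCM hdim h2
  rw [hI', hQ']
  refine ⟨⟨StarTransform.phi13_eq_sum (by omega) (by omega), StarTransform.phi3_w2 hββ' hγγ',
    StarTransform.admissible_v2 h2 y z β γ β' γ'⟩, ?_, hsymbolic,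
    hP.length_symbolicPower_three_minors hCM hdim h2⟩
  rw [← hsymbolic]
  exact hP.localDepth_quotient_symbolicPower_pos hCM hdim three_ne_zero
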